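/- Let $g\ge 0$, let $\pi=\pi_1(\Sigma_{g,1})$ be the fundamental group of a compact oriented surface of genus $g$ with connected boundary, i.e. a free group of rank $2g$, and let $H=H_1(\Sigma_{g,1};\mathbb{Q})=\mathbb{Q}\otimes_{\mathbb{Z}}\pi_{\mathrm{ab}}$. Let $I$ be the augmentation ideal of $\mathbb{Q}\pi$, let $\widehat{\mathbb{Q}\pi}=\varprojlim_m\mathbb{Q}\pi/I^m$, and let $\hat I$ be the kernel of the augmentation $\epsilon\colon\widehat{\mathbb{Q}\pi}\to\mathbb{Q}$. For $m\ge 1$ let $H_1^{\mathrm{Lie}}(\hat I/\hat I^m)$ be the quotient of $\hat I/\hat I^m$ by the subspace spanned by the commutators $xy-yx$ with $x,y\in\hat I/\hat I^m$. Let $\hat T=\prod_{k\ge 0}H^{\otimes k}$ be the completed tensor algebra of $H$ and $\hat T_m=\prod_{k\ge m}H^{\otimes k}$. A Magnus expansion is a group homomorphism $\theta\colon\pi\to 1+\hat T_1$ with $\theta(\gamma)\equiv 1+[\gamma]$ modulo $\hat T_2$ for all $\gamma\in\pi$. It induces algebra homomorphisms $\widehat{\mathbb{Q}\pi}/\hat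 I^{m}\to\hat T/\hat T_{m}$. For $n\ge 1$ let $H^{\otimes n}/\mathbb{Z}_n$ be the space of coinvariants of the cyclic permutations of the tensor factors. Taking the degree $n$ part and projecting to the coinvariants, $\theta$ induces a map $$\theta_*\colon\operatorname{Ker}\bigl(H_1^{\mathrm{Lie}}(\hat I/\hat I^{n+1})\to H_1^{\mathrm{Lie}}(\hat I/\hat I^{n})\bigr)\to H^{\otimes n}/\mathbb{Z}_n .$$ For $A\in\mathrm{GL}(N,\widehat{\mathbb{Q}\pi}/\hat I^{n+1})$ let $\epsilon(A)\in\mathrm{GL}(N,\mathbb{Q})$ be obtained by applying $\epsilon$ to all entries, and put $\log B=\sum_{k\ge 1}\frac{(-1)^{k-1}}{k}(B-I_N)^k$ for $B=A\epsilon(A)^{-1}$ (a finite sum). Regard $\operatorname{tr}(\log B)$ as an element of $H_1^{\mathrm{Lie}}(\hat I/\hat I^{n+1})$. Then for every $n\ge 1$ there is exactly one homomorphism $$\ell\!\operatorname{det}_n\colon\operatorname{Ker}\bigl(K_1(\widehat{\mathbb{Q}\pi}/\hat I^{n+1})\to K_1(\widehat{\mathbb{Q}\pi}/\hat I^{n})\bigr)\to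 H^{\otimes n}/\mathbb{Z}_n$$ such that, for every Magnus expansion $\theta$, every $N$ and every $A\in\mathrm{GL}(N,\widehat{\mathbb{Q}\pi}/\hat I^{n+1})$ whose class belongs to this kernel, $\operatorname{tr}(\log(A\epsilon(A)^{-1}))$ belongs to the domain of $\theta_*$ and $$\ell\!\operatorname{det}_n(A)=(\theta_*\circ\operatorname{tr}\circ\log)(A\epsilon(A)^{-1}),$$ and $\ell\!\operatorname{det}_n$ is an isomorphism. In particular, for $n=1$, $\ell\!\operatorname{det}_1(A)=\theta_*(\operatorname{tr}(A\epsilon(A)^{-1}-I_N))$ for every $A\in\mathrm{GL}(N,\widehat{\mathbb{Q}\pi}/\hat I^{2})$ whose class belongs to $\operatorname{Ker}(K_1(\widehat{\mathbb{Q}\pi}/\hat I^{2})\to K_1(\widehat{\mathbb{Q}\pi}/\hat I))$. -/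

import Mathlib

open scoped TensorProduct

noncomputable section

namespace LogDet

/-! ### The group `K₁` of a ring -/

section K1

variable {R : Type*} [Ring R] {S : Type*} [Ring S]

/-- The block sum `A ⊕ 1`: an `N × N` matrix `A` enlarged to an `M × M` matrix, for `N ≤ M`. -/
def blockOneFun {N M : ℕ} (A : Matrix (Fin N) (Fin N) R) : Matrix (Fin M) (Fin M) R :=
  Matrix.of fun i j =>
    if hij : (i : ℕ) < N ∧ (j : ℕ) < N then A ⟨i, hij.1⟩ ⟨j, hij.2⟩ else if i = j then 1 else 0

theorem blockOneFun_apply {N M : ℕ} (A : Matrix (Fin N) (Fin N) R) (i j : Fin M) :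
    blockOneFun A i j =
      if hij : (i : ℕ) < N ∧ (j : ℕ) < N then A ⟨i, hij.1⟩ ⟨j, hij.2⟩ else if i = j then 1 else 0 :=
  rfl

/-- The block sum `A ↦ A ⊕ 1` as a multiplicative map, for `N ≤ M`. -/
def blockOne (R : Type*) [Ring R] {N M : ℕ} (h : N ≤ M) :
    Matrix (Fin N) (Fin N) R →* Matrix (Fin M) (Fin M) R where
  toFun A := blockOneFun A
  map_one' := by
    ext i j
    rw [blockOneFun_apply]
    by_cases hij : (i : ℕ) < N ∧ (j : ℕ) < N
    · simp [hij, Matrix.one_apply, Fin.ext_iff]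
    · simp [hij, Matrix.one_apply]
  map_mul' A B := by
    ext i j
    rw [Matrix.mul_apply]
    simp only [blockOneFun_apply]
    by_cases hi : (i : ℕ) < N
    · have key : (∑ k : Fin N, A ⟨i, hi⟩ k *
          (if hj : (j : ℕ) < N then B k ⟨j, hj⟩ else 0)) =
          ∑ k : Fin M,
            (if hij : (i : ℕ) < N ∧ (k : ℕ) < N then A ⟨i, hij.1⟩ ⟨k, hij.2⟩
              else if i = k then 1 else 0) *
            (if hij : (k : ℕ) < N ∧ (j : ℕ) < N then B ⟨k, hij.1⟩ ⟨j, hij.2⟩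
              else if k = j then 1 else 0) := by
        refine Fintype.sum_of_injective (Fin.castLE h) (Fin.castLE_injective h) _ _ ?_ ?_
        · intro k hk
          have hk' : ¬ (k : ℕ) < N := fun hlt => hk ⟨⟨k, hlt⟩, rfl⟩
          have hik : i ≠ k := by
            rintro rfl
            exact hk' hi
          simp [hk', hik]
        · intro k
          by_cases hj : (j : ℕ) < N
          · simp [hi, hj]
          · have hkj : Fin.castLE h k ≠ j := by
              rintro rfl
              exact hj k.2
            simp [hj, hkj]
      rw [← key]
      by_cases hj : (j : ℕ) < N
      · simp [hi, hj, Matrix.mul_apply]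
      · have hij : i ≠ j := by
          rintro rfl
          exact hj hi
        simp [hj, hij]
    · rw [Finset.sum_eq_single i]
      · simp [hi]
      · intro k _ hk
        simp [hi, hk.symm]
      · simp

/-- The stabilization map `GL(N, R) → GL(M, R)`, `A ↦ A ⊕ 1`, for `N ≤ M`. -/
def stab (R : Type*) [Ring R] (N M : ℕ) (h : N ≤ M) : GL (Fin N) R →* GL (Fin M) R :=
  Units.map (blockOne R h)

instance : DirectedSystem (fun N : ℕ => GL (Fin N) R) fun N M h => ⇑(stab R N M h) where
  map_self N A := by
    apply Units.ext
    ext i j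
    change blockOneFun _ i j = _
    simp [blockOneFun_apply]
  map_map N M K h₁ h₂ A := by
    apply Units.ext
    ext i j
    change blockOneFun (blockOneFun _) i j = blockOneFun _ i j
    simp only [blockOneFun_apply]
    split_ifs <;> first | rfl | (exfalso; simp_all; done) | (exfalso; simp_all; omega)

/-- The stable general linear group `GL(R) = colim_N GL(N, R)`. -/
abbrev GLInf (R : Type*) [Ring R] : Type _ := DirectLimit (fun N : ℕ => GL (Fin N) R) (stab R)

/-- `K₁(R)`, the abelianization of the stable general linear group. -/
abbrev K1 (R : Type*) [Ring R] : Type _ := Abelianization (GLInf R)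

/-- The class in `K₁(R)` of an invertible matrix `A ∈ GL(N, R)`. -/
def K1.mk {N : ℕ} (A : GL (Fin N) R) : K1 R :=
  Abelianization.of (⟦⟨N, A⟩⟧ : GLInf R)

/-- Entrywise application of a ring homomorphism to invertible matrices. -/
def glMap (f : R →+* S) (N : ℕ) : GL (Fin N) R →* GL (Fin N) S :=
  Units.map (f.mapMatrix : Matrix (Fin N) (Fin N) R →+* Matrix (Fin N) (Fin N) S).toMonoidHom

theorem glMap_stab (f : R →+* S) (N M : ℕ) (h : N ≤ M) (A : GL (Fin N) R) :
    stab S N M h (glMap f N A) = glMap f M (stab R N M h A) := by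
  apply Units.ext
  ext i j
  change blockOneFun _ i j = f (blockOneFun _ i j)
  simp only [blockOneFun_apply]
  split_ifs <;> simp [glMap]

/-- The homomorphism `GL(R) → GL(S)` induced by a ring homomorphism. -/
def GLInf.map (f : R →+* S) : GLInf R →* GLInf S :=
  MonoidHom.mk' (DirectLimit.map (stab R) (stab S) (fun N => glMap f N) (glMap_stab f)) (by
    refine DirectLimit.induction₂ _ fun N A B => ?_
    rw [DirectLimit.mul_def, DirectLimit.map_def, DirectLimit.map_def, DirectLimit.map_def,
      DirectLimit.mul_def, map_mul])

/-- The homomorphism `K₁(R) → K₁(S)` induced by a ring homomorphism. -/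
def K1.map (f : R →+* S) : K1 R →* K1 S :=
  Abelianization.map (GLInf.map f)

end K1

/-! ### Completion of an augmented algebra -/

section Completion

variable {R : Type*} [Ring R] [Algebra ℚ R] (ε : R →ₐ[ℚ] ℚ)

/-- The augmentation ideal `I = ker ε`. -/
abbrev augIdeal : Ideal R := RingHom.ker ε

/-- The completion `R̂ = lim_m R / I ^ m`. -/
def completion : Subalgebra ℚ (∀ m : ℕ, R ⧸ augIdeal ε ^ m) where
  carrier := {x | ∀ k m : ℕ, ∀ h : k ≤ m,
    Ideal.Quotient.factor (Ideal.pow_le_pow_right (I := augIdeal ε) h) (x m) = x k}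
  mul_mem' hx hy k m h := by
    rw [Pi.mul_apply, Pi.mul_apply, map_mul, hx k m h, hy k m h]
  add_mem' hx hy k m h := by
    rw [Pi.add_apply, Pi.add_apply, map_add, hx k m h, hy k m h]
  algebraMap_mem' _ _ _ _ := rfl

/-- The projection `R̂ → R / I ^ m`. -/
def proj (m : ℕ) : completion ε →ₐ[ℚ] R ⧸ augIdeal ε ^ m :=
  (Pi.evalAlgHom ℚ _ m).comp (completion ε).val

/-- The augmentation `R̂ → R / I → ℚ`. -/
def augHat : completion ε →ₐ[ℚ] ℚ :=
  (Ideal.Quotient.liftₐ (augIdeal ε ^ 1) ε (fun a ha => by rwa [Submodule.pow_one] at ha)).comp (proj ε 1)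

/-- The augmentation ideal `Î` of `R̂`. -/
abbrev hatIdeal : Ideal (completion ε) := augIdeal (augHat ε)

/-- The quotient `R̂ / Î ^ m`. -/
abbrev HatQuot (m : ℕ) : Type _ := completion ε ⧸ hatIdeal ε ^ m

/-- The ideal `Î / Î ^ m` of `R̂ / Î ^ m` (the image of `Î`). -/
def hatQuotIdeal (m : ℕ) : Submodule ℚ (HatQuot ε m) :=
  (LinearMap.ker (augHat ε).toLinearMap).map
    (Ideal.Quotient.mkₐ ℚ (hatIdeal ε ^ m)).toLinearMap

/-- The reduction `R̂ / Î ^ (n + 1) → R̂ / Î ^ n`. -/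
def red (n : ℕ) : HatQuot ε (n + 1) →ₐ[ℚ] HatQuot ε n :=
  Ideal.Quotient.factorₐ ℚ (Ideal.pow_le_pow_right (Nat.le_succ n))

/-- The augmentation `R̂ / Î ^ (n + 1) → ℚ`. -/
def augQuot (n : ℕ) : HatQuot ε (n + 1) →ₐ[ℚ] ℚ :=
  Ideal.Quotient.liftₐ (hatIdeal ε ^ (n + 1)) (augHat ε) fun _ ha =>
    Ideal.pow_le_self (Nat.succ_ne_zero n) ha

theorem augQuot_eq_zero_iff (n : ℕ) (x : HatQuot ε (n + 1)) :
    augQuot ε n x = 0 ↔ x ∈ hatQuotIdeal ε (n + 1) := by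
  constructor
  · obtain ⟨y, rfl⟩ := Ideal.Quotient.mk_surjective x
    intro h
    exact ⟨y, h, rfl⟩
  · rintro ⟨y, hy, rfl⟩
    exact hy

theorem proj_mem_of_mem_hatIdeal_pow (k : ℕ) :
    ∀ x ∈ hatIdeal ε ^ k, ∀ m, ∃ r ∈ augIdeal ε ^ k, proj ε m x = Ideal.Quotient.mk _ r := by
  induction k with
  | zero =>
    intro x _ m
    obtain ⟨r, hr⟩ := Ideal.Quotient.mk_surjective (proj ε m x)
    exact ⟨r, by rw [Submodule.pow_zero, Ideal.one_eq_top]; trivial, hr.symm⟩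
  | succ k ih =>
    have h1 : ∀ x ∈ hatIdeal ε, ∀ m, ∃ r ∈ augIdeal ε, proj ε m x = Ideal.Quotient.mk _ r := by
      intro x hx m
      cases m with
      | zero =>
        refine ⟨0, Ideal.zero_mem _, ?_⟩
        obtain ⟨r, hr⟩ := Ideal.Quotient.mk_surjective (proj ε 0 x)
        rw [← hr, Ideal.Quotient.eq, Submodule.pow_zero, Ideal.one_eq_top]
        trivial
      | succ m =>
        obtain ⟨r, hr⟩ := Ideal.Quotient.mk_surjective (proj ε (m + 1) x)
        refine ⟨r, ?_, hr.symm⟩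
        have h := x.2 1 (m + 1) (by omega)
        have h' : proj ε 1 x = Ideal.Quotient.mk _ r := by
          change x.1 1 = _
          rw [← h]
          change Ideal.Quotient.factor _ (proj ε (m + 1) x) = _
          rw [← hr]
          rfl
        have h'' : augHat ε x = 0 := hx
        rw [augHat, AlgHom.comp_apply, h'] at h''
        exact h''
    intro x hx m
    rw [Submodule.pow_succ] at hx
    refine Submodule.mul_induction_on hx ?_ ?_
    · intro a ha c hc
      obtain ⟨r, hr, hr'⟩ := ih a ha m
      obtain ⟨t, ht, ht'⟩ := h1 c hc m
      refine ⟨r * t, ?_, ?_⟩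
      · rw [Submodule.pow_succ]
        exact Ideal.mul_mem_mul hr ht
      · rw [map_mul, map_mul, hr', ht']
    · rintro a c ⟨r, hr, hr'⟩ ⟨t, ht, ht'⟩
      exact ⟨r + t, Ideal.add_mem _ hr ht, by rw [map_add, map_add, hr', ht']⟩

/-- The canonical map `R̂ / Î ^ m → R / I ^ m`. -/
def toQuot (m : ℕ) : HatQuot ε m →ₐ[ℚ] R ⧸ augIdeal ε ^ m :=
  Ideal.Quotient.liftₐ (hatIdeal ε ^ m) (proj ε m) fun x hx => by
    obtain ⟨r, hr, hr'⟩ := proj_mem_of_mem_hatIdeal_pow ε m x hx m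
    rw [hr']
    exact Ideal.Quotient.eq_zero_iff_mem.mpr hr

end Completion

/-! ### The abelianization of the Lie algebra `J`, and the log-determinant -/

section LieAb

variable {S : Type*} [Ring S] [Algebra ℚ S] {S' : Type*} [Ring S'] [Algebra ℚ S']

/-- The span `[J, J]` of the commutators `x y - y x` of elements of `J`, as a subspace of `J`
(for an ideal `J` all these commutators belong to `J`). -/
def commSpan (J : Submodule ℚ S) : Submodule ℚ J :=
  Submodule.span ℚ {z : J | ∃ x y : J, (z : S) = x * y - y * x}

/-- `H₁^Lie(J) = J / [J, J]`. -/
abbrev H1Lie (J : Submodule ℚ S) : Type _ := J ⧸ commSpan J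

/-- The map `H₁^Lie(J) → H₁^Lie(J')` induced by an algebra homomorphism that maps `J` to `J'`. -/
def H1Lie.map (f : S →ₐ[ℚ] S') (J : Submodule ℚ S) (J' : Submodule ℚ S')
    (h : ∀ x ∈ J, f.toLinearMap x ∈ J') : H1Lie J →ₗ[ℚ] H1Lie J' :=
  (commSpan J).mapQ (commSpan J') (f.toLinearMap.restrict h) (by
    refine Submodule.span_le.mpr ?_
    rintro z ⟨x, y, hz⟩
    refine Submodule.subset_span ⟨⟨f x, h x x.2⟩, ⟨f y, h y y.2⟩, ?_⟩
    change f z = f x * f y - f y * f x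
    rw [hz, map_sub, map_mul, map_mul])

/-- The class in `H₁^Lie(J)` of the trace of a matrix with entries in `J`. -/
def trClass (J : Submodule ℚ S) {N : ℕ} (X : Matrix (Fin N) (Fin N) S)
    (hX : ∀ i j, X i j ∈ J) : H1Lie J :=
  (commSpan J).mkQ ⟨X.trace, J.sum_mem fun i _ => hX i i⟩

/-- `log B = ∑_{k ≥ 1} (-1) ^ (k - 1) / k • (B - 1) ^ k`. It is used when `B - 1` is nilpotent,
and then all but finitely many terms vanish. -/
def logMatrix {N : ℕ} (B : Matrix (Fin N) (Fin N) S) : Matrix (Fin N) (Fin N) S :=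
  ∑ᶠ k : ℕ, ((-1 : ℚ) ^ k / ((k : ℚ) + 1)) • (B - 1) ^ (k + 1)

/-- The matrix `A ε(A)⁻¹`, where `ε(A) ∈ GL(N, ℚ)` is viewed in `GL(N, S)`. -/
def normalized (ε : S →ₐ[ℚ] ℚ) {N : ℕ} (A : GL (Fin N) S) : GL (Fin N) S :=
  A * (glMap (algebraMap ℚ S) N (glMap (ε : S →+* ℚ) N A))⁻¹

theorem normalized_sub_one (ε : S →ₐ[ℚ] ℚ) {N : ℕ} (A : GL (Fin N) S) :
    (ε : S →+* ℚ).mapMatrix ((normalized ε A : Matrix (Fin N) (Fin N) S) - 1) = 0 := by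
  have h : glMap (ε : S →+* ℚ) N (normalized ε A) = 1 := by
    have h2 : ∀ C : GL (Fin N) ℚ, glMap (ε : S →+* ℚ) N (glMap (algebraMap ℚ S) N C) = C := by
      intro C
      apply Units.ext
      ext i j
      simp [glMap]
    rw [normalized, map_mul, map_inv, h2, mul_inv_cancel]
  have h' := congrArg Units.val h
  rw [map_sub, map_one, sub_eq_zero]
  exact h'

theorem normalized_sub_one_mem (ε : S →ₐ[ℚ] ℚ) {N : ℕ} (A : GL (Fin N) S) (i j : Fin N) :
    ε (((normalized ε A : Matrix (Fin N) (Fin N) S) - 1) i j) = 0 :=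
  congrFun (congrFun (normalized_sub_one ε A) i) j

theorem logMatrix_normalized_mem (ε : S →ₐ[ℚ] ℚ) {N : ℕ} (A : GL (Fin N) S) (i j : Fin N) :
    ε (logMatrix (normalized ε A : Matrix (Fin N) (Fin N) S) i j) = 0 := by
  let K : AddSubgroup (Matrix (Fin N) (Fin N) S) :=
    ((ε : S →+* ℚ).mapMatrix : Matrix (Fin N) (Fin N) S →+* Matrix (Fin N) (Fin N) ℚ)
      |>.toAddMonoidHom.ker
  have hK : logMatrix (normalized ε A : Matrix (Fin N) (Fin N) S) ∈ K := by
    refine finsum_induction (· ∈ K) K.zero_mem (fun _ _ => K.add_mem) fun k => ?_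
    change (ε : S →+* ℚ).mapMatrix _ = 0
    have h0 : (ε : S →+* ℚ).mapMatrix
        (((normalized ε A : Matrix (Fin N) (Fin N) S) - 1) ^ (k + 1)) = 0 := by
      rw [map_pow, normalized_sub_one, zero_pow (Nat.succ_ne_zero k)]
    ext i j
    have := congrFun (congrFun h0 i) j
    simp only [RingHom.mapMatrix_apply, Matrix.map_apply, Matrix.zero_apply, RingHom.coe_coe,
      Matrix.smul_apply, map_smul] at this ⊢
    rw [this, smul_zero]
  exact congrFun (congrFun (show (ε : S →+* ℚ).mapMatrix _ = 0 from hK) i) j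

end LieAb

section LogDetQuot

variable {R : Type*} [Ring R] [Algebra ℚ R] (ε : R →ₐ[ℚ] ℚ)

/-- The map `H₁^Lie(Î / Î ^ (n + 1)) → H₁^Lie(Î / Î ^ n)`. -/
def H1LieRed (n : ℕ) : H1Lie (hatQuotIdeal ε (n + 1)) →ₗ[ℚ] H1Lie (hatQuotIdeal ε n) :=
  H1Lie.map (red ε n) _ _ (by
    rintro _ ⟨y, hy, rfl⟩
    exact ⟨y, hy, rfl⟩)

/-- The log-determinant `tr (log (A ε(A)⁻¹)) ∈ H₁^Lie(Î / Î ^ (n + 1))` of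
`A ∈ GL(N, R̂ / Î ^ (n + 1))`. -/
def ldet (n : ℕ) {N : ℕ} (A : GL (Fin N) (HatQuot ε (n + 1))) :
    H1Lie (hatQuotIdeal ε (n + 1)) :=
  trClass (hatQuotIdeal ε (n + 1))
    (logMatrix (normalized (augQuot ε n) A : Matrix (Fin N) (Fin N) (HatQuot ε (n + 1))))
    fun i j => (augQuot_eq_zero_iff ε n _).mp (logMatrix_normalized_mem (augQuot ε n) A i j)

/-- The class of `tr (A ε(A)⁻¹ - 1)` in `H₁^Lie(Î / Î ^ (n + 1))`, for
`A ∈ GL(N, R̂ / Î ^ (n + 1))`. -/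
def linDet (n : ℕ) {N : ℕ} (A : GL (Fin N) (HatQuot ε (n + 1))) :
    H1Lie (hatQuotIdeal ε (n + 1)) :=
  trClass (hatQuotIdeal ε (n + 1))
    ((normalized (augQuot ε n) A : Matrix (Fin N) (Fin N) (HatQuot ε (n + 1))) - 1)
    fun i j => (augQuot_eq_zero_iff ε n _).mp (normalized_sub_one_mem (augQuot ε n) A i j)

end LogDetQuot

/-! ### Cyclic coinvariants and the completed tensor algebra -/

section Tensor

variable (H : Type*) [AddCommGroup H] [Module ℚ H]

/-- The span of the elements `σ ^ k • t - t` of `H ^ ⊗ n`, where the generator `σ` of the cyclic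
group `ℤ_n` acts by the cyclic permutation of the tensor factors. -/
def cycSpan (n : ℕ) : Submodule ℚ (⨂[ℚ]^n H) :=
  Submodule.span ℚ {z | ∃ (k : ℕ) (t : ⨂[ℚ]^n H),
    z = PiTensorProduct.reindex ℚ (fun _ => H) (finRotate n ^ k) t - t}

/-- `H ^ ⊗ n / ℤ_n`, the coinvariants of the cyclic permutations. -/
abbrev CycTensor (n : ℕ) : Type _ := (⨂[ℚ]^n H) ⧸ cycSpan H n

/-- The degree `n` part `T(H) → H ^ ⊗ n`. -/
def degPart (n : ℕ) : TensorAlgebra ℚ H →ₗ[ℚ] ⨂[ℚ]^n H :=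
  (DirectSum.component ℚ ℕ (fun m => ⨂[ℚ]^m H) n) ∘ₗ
    (TensorAlgebra.equivDirectSum (R := ℚ) (M := H)).toLinearMap

/-- The degree `n` part followed by the projection `H ^ ⊗ n → H ^ ⊗ n / ℤ_n`. -/
def cycPart (n : ℕ) : TensorAlgebra ℚ H →ₗ[ℚ] CycTensor H n :=
  (cycSpan H n).mkQ ∘ₗ degPart H n

variable {H}

theorem cycPart_ι_mul (n : ℕ) (x : H) (b : TensorAlgebra ℚ H) :
    cycPart H n (TensorAlgebra.ι ℚ x * b) = cycPart H n (b * TensorAlgebra.ι ℚ x) := by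
  obtain ⟨d, rfl⟩ := (TensorAlgebra.equivDirectSum (R := ℚ) (M := H)).symm.surjective b
  induction d using DirectSum.induction_on with
  | zero => simp
  | add d e hd he => rw [map_add, mul_add, add_mul, map_add, map_add, hd, he]
  | of m t =>
    induction t using PiTensorProduct.induction_on with
    | add t s ht hs => rw [map_add, map_add, mul_add, add_mul, map_add, map_add, ht, hs]
    | smul_tprod r v =>
      have h1 : (TensorAlgebra.equivDirectSum (R := ℚ) (M := H)).symm
          (DirectSum.of (fun n => ⨂[ℚ]^n H) m (r • PiTensorProduct.tprod ℚ v)) =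
          r • TensorAlgebra.tprod ℚ H m v := by
        rw [← TensorAlgebra.ofDirectSum_of_tprod, ← DirectSum.lof_eq_of ℚ, LinearMap.map_smul,
          map_smul]
        rfl
      rw [h1, mul_smul_comm, smul_mul_assoc, map_smul, map_smul]
      congr 1
      have h2 : TensorAlgebra.ι ℚ x * TensorAlgebra.tprod ℚ H m v =
          TensorAlgebra.tprod ℚ H (m + 1) (Fin.cons x v) := by
        simp [TensorAlgebra.tprod_apply, List.ofFn_succ]
      have h3 : TensorAlgebra.tprod ℚ H m v * TensorAlgebra.ι ℚ x =
          TensorAlgebra.tprod ℚ H (m + 1) (Fin.snoc v x) := by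
        simp only [TensorAlgebra.tprod_apply, List.ofFn_succ', List.concat_eq_append,
          List.prod_append, Fin.snoc_castSucc, Fin.snoc_last, List.prod_singleton]
      have h4 : ∀ w : Fin (m + 1) → H, degPart H n (TensorAlgebra.tprod ℚ H (m + 1) w) =
          DirectSum.component ℚ ℕ (fun m => ⨂[ℚ]^m H) n
            (DirectSum.of (fun n => ⨂[ℚ]^n H) (m + 1) (PiTensorProduct.tprod ℚ w)) := by
        intro w
        rw [← TensorAlgebra.toDirectSum_tensorPower_tprod]
        rfl
      rw [h2, h3, cycPart, LinearMap.comp_apply, LinearMap.comp_apply, h4, h4]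
      by_cases hn : n = m + 1
      · subst hn
        rw [← DirectSum.lof_eq_of ℚ, ← DirectSum.lof_eq_of ℚ, DirectSum.component.lof_self,
          DirectSum.component.lof_self, ← sub_eq_zero, ← map_sub, Submodule.mkQ_apply,
          Submodule.Quotient.mk_eq_zero]
        refine Submodule.subset_span ⟨1, PiTensorProduct.tprod ℚ (Fin.snoc v x), ?_⟩
        rw [PiTensorProduct.reindex_tprod, Fin.snoc_eq_cons_rotate]
        simp
      · rw [← DirectSum.lof_eq_of ℚ, ← DirectSum.lof_eq_of ℚ, DirectSum.component.of,
          DirectSum.component.of, dif_neg (Ne.symm hn), dif_neg (Ne.symm hn)]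

theorem cycPart_mul_comm (n : ℕ) (a b : TensorAlgebra ℚ H) :
    cycPart H n (a * b) = cycPart H n (b * a) := by
  induction a using TensorAlgebra.induction generalizing b with
  | algebraMap r => rw [Algebra.commutes]
  | ι x => exact cycPart_ι_mul n x b
  | mul a c ha hc => rw [mul_assoc, ha, mul_assoc, hc, mul_assoc]
  | add a c ha hc => rw [add_mul, mul_add, map_add, map_add, ha, hc]

variable (H)

/-- The completed tensor algebra `T̂ = ∏_k H ^ ⊗ k`: a sequence of tensors `f_k` of degree `k` is
written as the power series with coefficients `f_k`, so that the product is the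
product of power series, and `H ^ ⊗ k` is the degree `k` component of the tensor algebra. -/
def completedTensor : Subalgebra ℚ (PowerSeries (TensorAlgebra ℚ H)) where
  carrier := {f | ∀ k, PowerSeries.coeff k f ∈ LinearMap.range (TensorAlgebra.ι ℚ (M := H)) ^ k}
  mul_mem' {f f'} hf hf' k := by
    rw [PowerSeries.coeff_mul]
    refine Submodule.sum_mem _ fun p hp => ?_
    rw [← Finset.HasAntidiagonal.mem_antidiagonal.mp hp, pow_add]
    exact Submodule.mul_mem_mul (hf _) (hf' _)
  add_mem' hf hf' k := by
    rw [map_add]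
    exact Submodule.add_mem _ (hf k) (hf' k)
  algebraMap_mem' r k := by
    rw [PowerSeries.algebraMap_apply, PowerSeries.coeff_C]
    split_ifs with h
    · subst h
      rw [pow_zero]
      exact Submodule.algebraMap_mem r
    · exact Submodule.zero_mem _

/-- The coefficient map `T̂ → T(H)` onto the component of degree `k`. -/
def tensorCoeff (k : ℕ) : completedTensor H →ₗ[ℚ] TensorAlgebra ℚ H where
  toFun f := PowerSeries.coeff k (f : PowerSeries (TensorAlgebra ℚ H))
  map_add' f f' := by simp
  map_smul' r f := by simp

end Tensor

/-! ### Magnus expansions -/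

section Magnus

variable (π : Type*) [Group π]

/-- `H = H₁(π; ℚ) = ℚ ⊗ π_ab`. -/
abbrev RatH1 : Type _ := ℚ ⊗[ℤ] Additive (Abelianization π)

variable {π} in
/-- The class `[γ] ∈ H` of `γ ∈ π`. -/
def homClass (γ : π) : RatH1 π := 1 ⊗ₜ[ℤ] Additive.ofMul (Abelianization.of γ)

/-- The augmentation `ℚπ → ℚ`, which maps every element of `π` to `1`. -/
def groupAug : MonoidAlgebra ℚ π →ₐ[ℚ] ℚ := MonoidAlgebra.lift ℚ ℚ π 1

/-- A Magnus expansion: a homomorphism `θ` from `π` to the multiplicative group `1 + T̂_1` such that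
`θ(γ) ≡ 1 + [γ]` modulo `T̂_2`, where `T̂_k` consists of the elements of `T̂` without components
of degree less than `k`. -/
structure MagnusExpansion where
  toHom : π →* completedTensor (RatH1 π)
  coeff_zero : ∀ γ, tensorCoeff (RatH1 π) 0 (toHom γ) = 1
  coeff_one : ∀ γ, tensorCoeff (RatH1 π) 1 (toHom γ) = TensorAlgebra.ι ℚ (homClass γ)

variable {π}

/-- The algebra homomorphism `ℚπ → T̂` that extends a Magnus expansion. -/
def MagnusExpansion.algHom (θ : MagnusExpansion π) :
    MonoidAlgebra ℚ π →ₐ[ℚ] completedTensor (RatH1 π) :=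
  MonoidAlgebra.lift ℚ _ π θ.toHom

theorem MagnusExpansion.tensorCoeff_zero_algHom (θ : MagnusExpansion π) (x : MonoidAlgebra ℚ π) :
    tensorCoeff (RatH1 π) 0 (θ.algHom x) = algebraMap ℚ _ (groupAug π x) := by
  have h : tensorCoeff (RatH1 π) 0 ∘ₗ θ.algHom.toLinearMap =
      (Algebra.linearMap ℚ (TensorAlgebra ℚ (RatH1 π))) ∘ₗ (groupAug π).toLinearMap := by
    refine MonoidAlgebra.lhom_ext' fun γ => ?_
    ext
    simp [MagnusExpansion.algHom, groupAug, θ.coeff_zero]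
  exact LinearMap.congr_fun h x

/-- A Magnus expansion maps `I ^ m` to `T̂_m`. -/
theorem MagnusExpansion.tensorCoeff_algHom_eq_zero (θ : MagnusExpansion π) (m : ℕ) :
    ∀ x ∈ augIdeal (groupAug π) ^ m, ∀ k < m, tensorCoeff (RatH1 π) k (θ.algHom x) = 0 := by
  induction m with
  | zero => intro x _ k hk; omega
  | succ m ih =>
    intro x hx k hk
    rw [Submodule.pow_succ] at hx
    refine Submodule.mul_induction_on hx ?_ ?_
    · intro a ha c hc
      change PowerSeries.coeff k ((θ.algHom (a * c) : completedTensor (RatH1 π)) :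
        PowerSeries (TensorAlgebra ℚ (RatH1 π))) = 0
      rw [map_mul, Subalgebra.coe_mul, PowerSeries.coeff_mul]
      refine Finset.sum_eq_zero fun p hp => ?_
      have hp' := Finset.HasAntidiagonal.mem_antidiagonal.mp hp
      by_cases h0 : p.2 = 0
      · have h1 : PowerSeries.coeff 0 ((θ.algHom c : completedTensor (RatH1 π)) :
            PowerSeries (TensorAlgebra ℚ (RatH1 π))) = 0 := by
          have h2 := θ.tensorCoeff_zero_algHom c
          rw [show groupAug π c = 0 from hc, map_zero] at h2
          exact h2
        rw [h0, h1, mul_zero]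
      · have h1 : PowerSeries.coeff p.1 ((θ.algHom a : completedTensor (RatH1 π)) :
            PowerSeries (TensorAlgebra ℚ (RatH1 π))) = 0 := ih a ha p.1 (by omega)
        rw [h1, zero_mul]
    · intro a c ha hc
      rw [map_add, map_add, ha, hc, add_zero]

/-- The linear map `ℚπ → T̂ → H ^ ⊗ n → H ^ ⊗ n / ℤ_n`. -/
def MagnusExpansion.cyc (θ : MagnusExpansion π) (n : ℕ) :
    MonoidAlgebra ℚ π →ₗ[ℚ] CycTensor (RatH1 π) n :=
  cycPart (RatH1 π) n ∘ₗ tensorCoeff (RatH1 π) n ∘ₗ θ.algHom.toLinearMap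

theorem MagnusExpansion.cyc_mul_comm (θ : MagnusExpansion π) (n : ℕ) (a b : MonoidAlgebra ℚ π) :
    θ.cyc n (a * b) = θ.cyc n (b * a) := by
  change cycPart (RatH1 π) n (PowerSeries.coeff n ((θ.algHom (a * b) : completedTensor (RatH1 π)) :
      PowerSeries (TensorAlgebra ℚ (RatH1 π)))) =
    cycPart (RatH1 π) n (PowerSeries.coeff n ((θ.algHom (b * a) : completedTensor (RatH1 π)) :
      PowerSeries (TensorAlgebra ℚ (RatH1 π))))
  rw [map_mul, map_mul, Subalgebra.coe_mul, Subalgebra.coe_mul, PowerSeries.coeff_mul,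
    PowerSeries.coeff_mul, map_sum, map_sum, ← Finset.Nat.sum_antidiagonal_swap]
  exact Finset.sum_congr rfl fun p _ => cycPart_mul_comm n _ _

/-- The map `ℚπ / I ^ (n + 1) → T̂ / T̂_{n + 1} → H ^ ⊗ n → H ^ ⊗ n / ℤ_n` induced by a Magnus
expansion. -/
def MagnusExpansion.cycQuot (θ : MagnusExpansion π) (n : ℕ) :
    (MonoidAlgebra ℚ π ⧸ augIdeal (groupAug π) ^ (n + 1)) →ₗ[ℚ] CycTensor (RatH1 π) n where
  toFun := QuotientAddGroup.lift (augIdeal (groupAug π) ^ (n + 1)).toAddSubgroup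
    (θ.cyc n).toAddMonoidHom (by
      intro x hx
      have h := θ.tensorCoeff_algHom_eq_zero (n + 1) x hx n (Nat.lt_succ_self n)
      change cycPart (RatH1 π) n (tensorCoeff (RatH1 π) n (θ.algHom x)) = 0
      rw [h, map_zero])
  map_add' x y := map_add (QuotientAddGroup.lift _ _ _) x y
  map_smul' r x := by
    obtain ⟨a, rfl⟩ := Ideal.Quotient.mk_surjective x
    exact (θ.cyc n).map_smul r a

theorem MagnusExpansion.cycQuot_mk (θ : MagnusExpansion π) (n : ℕ) (x : MonoidAlgebra ℚ π) :
    θ.cycQuot n (Ideal.Quotient.mk _ x) = θ.cyc n x := rfl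

/-- The map `ℚπ^ / Î ^ (n + 1) → ℚπ / I ^ (n + 1) → T̂ / T̂_{n + 1} → H ^ ⊗ n → H ^ ⊗ n / ℤ_n`
induced by a Magnus expansion, where `ℚπ^` is the completion of `ℚπ`. -/
def MagnusExpansion.cycHat (θ : MagnusExpansion π) (n : ℕ) :
    HatQuot (groupAug π) (n + 1) →ₗ[ℚ] CycTensor (RatH1 π) n :=
  θ.cycQuot n ∘ₗ (toQuot (groupAug π) (n + 1)).toLinearMap

theorem MagnusExpansion.cycHat_mul_comm (θ : MagnusExpansion π) (n : ℕ)
    (x y : HatQuot (groupAug π) (n + 1)) : θ.cycHat n (x * y) = θ.cycHat n (y * x) := by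
  obtain ⟨a, ha⟩ := Ideal.Quotient.mk_surjective (toQuot (groupAug π) (n + 1) x)
  obtain ⟨b, hb⟩ := Ideal.Quotient.mk_surjective (toQuot (groupAug π) (n + 1) y)
  change θ.cycQuot n (toQuot (groupAug π) (n + 1) (x * y)) =
    θ.cycQuot n (toQuot (groupAug π) (n + 1) (y * x))
  rw [map_mul (toQuot (groupAug π) (n + 1)), map_mul (toQuot (groupAug π) (n + 1)), ← ha, ← hb]
  exact θ.cyc_mul_comm n a b

/-- The map `θ_* : H₁^Lie(Î / Î ^ (n + 1)) → H ^ ⊗ n / ℤ_n` induced by a Magnus expansion. -/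
def MagnusExpansion.starAux (θ : MagnusExpansion π) (n : ℕ) :
    H1Lie (hatQuotIdeal (groupAug π) (n + 1)) →ₗ[ℚ] CycTensor (RatH1 π) n :=
  (commSpan (hatQuotIdeal (groupAug π) (n + 1))).liftQ
    (θ.cycHat n ∘ₗ (hatQuotIdeal (groupAug π) (n + 1)).subtype) (by
      refine Submodule.span_le.mpr ?_
      rintro z ⟨x, y, hz⟩
      change θ.cycHat n z = 0
      rw [hz, map_sub, θ.cycHat_mul_comm, sub_self])

/-- The map `θ_*` from the kernel of `H₁^Lie(Î / Î ^ (n + 1)) → H₁^Lie(Î / Î ^ n)` to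
`H ^ ⊗ n / ℤ_n` induced by a Magnus expansion `θ`. -/
def MagnusExpansion.star (θ : MagnusExpansion π) (n : ℕ) :
    LinearMap.ker (H1LieRed (groupAug π) n) →ₗ[ℚ] CycTensor (RatH1 π) n :=
  (θ.starAux n).domRestrict _

variable (π)

/-- The kernel of `K₁(ℚπ^ / Î ^ (n + 1)) → K₁(ℚπ^ / Î ^ n)`. -/
abbrev K1Ker (n : ℕ) : Subgroup (K1 (HatQuot (groupAug π) (n + 1))) :=
  (K1.map (red (groupAug π) n : HatQuot (groupAug π) (n + 1) →+* HatQuot (groupAug π) n)).ker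

variable {π}

/-- `Φ` is given by `Φ(A) = θ_*(tr (log (A ε(A)⁻¹)))` on every matrix `A` that
represents an element of the kernel, for every Magnus expansion `θ`; this includes the claim that
`tr (log (A ε(A)⁻¹))` belongs to the domain of `θ_*`. -/
def IsLogDet (n : ℕ) (Φ : K1Ker π n →* Multiplicative (CycTensor (RatH1 π) n)) : Prop :=
  ∀ (θ : MagnusExpansion π) (N : ℕ) (A : GL (Fin N) (HatQuot (groupAug π) (n + 1)))
    (hA : K1.mk A ∈ K1Ker π n),
    ∃ h : ldet (groupAug π) n A ∈ LinearMap.ker (H1LieRed (groupAug π) n),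
      Φ ⟨K1.mk A, hA⟩ = Multiplicative.ofAdd (θ.star n ⟨ldet (groupAug π) n A, h⟩)

end Magnus

end LogDet

end

/-! Let `Q` be the completed group algebra modulo the power `n + 1` of its augmentation ideal `I`.
The theorem compares two filtrations, of `K₁(Q)` by congruence modulo powers of `I` and of `Q` by
tensor degree.

Since `I` is nilpotent in `Q`, `tr ∘ log` composed with any functional that vanishes on commutators
is additive and stable, so it is a homomorphism on `K₁(Q)` (`K1.logTrace`). Additivity is a
derivative computation (`trace_logTrunc_mul`). If `X` has entries in `I ^ k`, `k ≥ 1`, and the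
functional kills `I ^ (k + 1)`, the value on `1 + X` is the value at `tr X` (`K1.logTrace_ofMat`).
Conversely, since `1 + ab` and `1 + ba` have the same class in `K₁`, a matrix `1 + X` whose trace is
a sum of commutators modulo `I ^ (k + 1)` has the class of a matrix of the same size congruent to
`1` modulo `I ^ (k + 1)` (`mem_congrStep_of_trace`).

For a free group of finite rank, every element of `I ^ k` has a homogeneous tensor of degree `k` as
leading term. Any Magnus expansion recovers the cyclic class of that tensor, and a tensor with zero
cyclic class is a sum of commutators (`ExtendsCycPart.detectsCommutators`). So the degree `k`
functional detects exactly the obstruction to passing from `I ^ k` to `I ^ (k + 1)`.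

A class that dies modulo `I ^ n` has trivial augmentation and trivial invariants in degrees below
`n`. Hence it is represented by some `1 + X` with entries of `X` in `I ^ n`
(`DetectsCommutators.mem_augCongr`), and its log-determinant is the cyclic class of `tr X`. This
gives independence of the expansion and membership in the domain of `θ_*`. If the value vanishes,
one more step reaches `I ^ (n + 1) = 0`, which is injectivity. The `1 × 1` matrices `1 + t` with `t
∈ I ^ n` give surjectivity. -/

noncomputable section

namespace LogDet

/-! ### Classes of matrices in `K₁` and its universal property. -/

section K1Basics

variable {R : Type*} [Ring R] {S : Type*} [Ring S]

/-- The class map `GL(N, R) → K₁(R)` as a homomorphism. -/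
def K1.mkHom (R : Type*) [Ring R] (N : ℕ) : GL (Fin N) R →* K1 R :=
  MonoidHom.mk' K1.mk fun A B => by
    rw [K1.mk, K1.mk, K1.mk, ← map_mul, DirectLimit.mul_def]

theorem K1.mk_mul {N : ℕ} (A B : GL (Fin N) R) : K1.mk (A * B) = K1.mk A * K1.mk B :=
  map_mul (K1.mkHom R N) A B

theorem K1.mk_one (N : ℕ) : K1.mk (1 : GL (Fin N) R) = 1 :=
  map_one (K1.mkHom R N)

theorem K1.mk_inv {N : ℕ} (A : GL (Fin N) R) : K1.mk A⁻¹ = (K1.mk A)⁻¹ :=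
  map_inv (K1.mkHom R N) A

theorem K1.mk_stab {N M : ℕ} (h : N ≤ M) (A : GL (Fin N) R) :
    K1.mk (stab R N M h A) = K1.mk A := by
  rw [K1.mk, K1.mk]
  congr 1
  exact Quotient.sound ⟨M, le_refl _, h, by
    exact (DirectedSystem.map_self (f := fun N M h => ⇑(stab R N M h)) _)⟩

theorem K1.mk_surjective (z : K1 R) : ∃ (N : ℕ) (A : GL (Fin N) R), K1.mk A = z := by
  obtain ⟨y, rfl⟩ := QuotientGroup.mk_surjective z
  obtain ⟨⟨N, A⟩, rfl⟩ := Quotient.exists_rep y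
  exact ⟨N, A, rfl⟩

theorem K1.map_mk (f : R →+* S) {N : ℕ} (A : GL (Fin N) R) :
    K1.map f (K1.mk A) = K1.mk (glMap f N A) := rfl

/-- The homomorphism from `K₁(R)` given by a compatible family of homomorphisms from the groups
`GL(N, R)` to an abelian group. -/
def K1.lift {V : Type*} [CommGroup V] (d : ∀ N, GL (Fin N) R →* V)
    (hd : ∀ N M (h : N ≤ M) (A : GL (Fin N) R), d M (stab R N M h A) = d N A) : K1 R →* V :=
  Abelianization.lift (MonoidHom.mk'
    (DirectLimit.lift (stab R) (fun N => d N) fun N M h A => (hd N M h A).symm) (by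
      refine DirectLimit.induction₂ _ fun N A B => ?_
      rw [DirectLimit.mul_def, DirectLimit.lift_def, DirectLimit.lift_def, DirectLimit.lift_def,
        map_mul]))

end K1Basics

/-! ### Elementary block matrices and the classes of `1 + ab` and `1 + ba`. -/

section Blocks

open Matrix

variable {R : Type*} [Ring R] {N : ℕ}

/-- The class in `K₁(R)` of an invertible `2 × 2` block matrix. -/
def K1.mkBlock (R : Type*) [Ring R] (N : ℕ) :
    (Matrix (Fin N ⊕ Fin N) (Fin N ⊕ Fin N) R)ˣ →* K1 R :=
  (K1.mkHom R (N + N)).comp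
    (Units.mapEquiv (Matrix.reindexRingEquiv R finSumFinEquiv).toMulEquiv).toMonoidHom

/-- The unit `[[1, a], [0, 1]]`. -/
def blockUpper (a : Matrix (Fin N) (Fin N) R) : (Matrix (Fin N ⊕ Fin N) (Fin N ⊕ Fin N) R)ˣ where
  val := fromBlocks 1 a 0 1
  inv := fromBlocks 1 (-a) 0 1
  val_inv := by simp [fromBlocks_multiply]
  inv_val := by simp [fromBlocks_multiply]

/-- The unit `[[1, 0], [a, 1]]`. -/
def blockLower (a : Matrix (Fin N) (Fin N) R) : (Matrix (Fin N ⊕ Fin N) (Fin N ⊕ Fin N) R)ˣ where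
  val := fromBlocks 1 0 a 1
  inv := fromBlocks 1 0 (-a) 1
  val_inv := by simp [fromBlocks_multiply]
  inv_val := by simp [fromBlocks_multiply]

/-- The unit `[[A, 0], [0, B]]`. -/
def blockDiag (A B : GL (Fin N) R) : (Matrix (Fin N ⊕ Fin N) (Fin N ⊕ Fin N) R)ˣ where
  val := fromBlocks A 0 0 B
  inv := fromBlocks ↑A⁻¹ 0 0 ↑B⁻¹
  val_inv := by simp [fromBlocks_multiply]
  inv_val := by simp [fromBlocks_multiply]

/-- The unit `[[0, 1], [1, 0]]`. -/
def blockSwap (R : Type*) [Ring R] (N : ℕ) :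
    (Matrix (Fin N ⊕ Fin N) (Fin N ⊕ Fin N) R)ˣ where
  val := fromBlocks 0 1 1 0
  inv := fromBlocks 0 1 1 0
  val_inv := by simp [fromBlocks_multiply]
  inv_val := by simp [fromBlocks_multiply]

theorem K1.mkBlock_blockDiag_left (A : GL (Fin N) R) :
    K1.mkBlock R N (blockDiag A 1) = K1.mk A := by
  rw [← K1.mk_stab (Nat.le_add_right N N) A]
  change K1.mk _ = _
  congr 1
  apply Units.ext
  ext i j
  change (fromBlocks (A : Matrix (Fin N) (Fin N) R) 0 0 1) (finSumFinEquiv.symm i)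
    (finSumFinEquiv.symm j) = blockOneFun _ i j
  rw [blockOneFun_apply]
  refine Fin.addCases (fun i => ?_) (fun i => ?_) i <;>
    refine Fin.addCases (fun j => ?_) (fun j => ?_) j
  · simp
  · rw [finSumFinEquiv_symm_apply_castAdd, finSumFinEquiv_symm_apply_natAdd, dif_neg (by simp),
      if_neg (by simp only [Fin.ext_iff, Fin.val_castAdd, Fin.val_natAdd]; omega)]
    rfl
  · rw [finSumFinEquiv_symm_apply_castAdd, finSumFinEquiv_symm_apply_natAdd, dif_neg (by simp),
      if_neg (by simp only [Fin.ext_iff, Fin.val_castAdd, Fin.val_natAdd]; omega)]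
    rfl
  · rw [finSumFinEquiv_symm_apply_natAdd, finSumFinEquiv_symm_apply_natAdd, dif_neg (by simp)]
    simp [Matrix.one_apply, Fin.ext_iff]

/-- The block swap conjugates one corner to the other, and conjugation is invisible in an abelian
group. -/
theorem K1.mkBlock_blockDiag_right (A : GL (Fin N) R) :
    K1.mkBlock R N (blockDiag 1 A) = K1.mk A := by
  have h : blockSwap R N * blockDiag 1 A = blockDiag A 1 * blockSwap R N := by
    apply Units.ext
    simp [blockSwap, blockDiag, fromBlocks_multiply]
  have h' := congrArg (K1.mkBlock R N) h
  rw [map_mul, map_mul, mul_comm, mul_right_cancel_iff, K1.mkBlock_blockDiag_left] at h'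
  exact h'

variable [Algebra ℚ R]

/-- The invertible scalar matrix `2`. -/
def twoGL (R : Type*) [Ring R] [Algebra ℚ R] (N : ℕ) : GL (Fin N) R where
  val := (2 : ℚ) • 1
  inv := (2 : ℚ)⁻¹ • 1
  val_inv := by simp
  inv_val := by simp

/-- Conjugation by `diag(2, 1)` doubles `a`, so the class `z` satisfies `z = z ^ 2`. Invertibility
of `2` replaces the usual expression of elementary matrices as commutators. -/
theorem K1.mkBlock_blockUpper (a : Matrix (Fin N) (Fin N) R) :
    K1.mkBlock R N (blockUpper a) = 1 := by
  have h : blockDiag (twoGL R N) 1 * blockUpper a =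
      blockUpper a * blockUpper a * blockDiag (twoGL R N) 1 := by
    apply Units.ext
    simp [blockUpper, blockDiag, twoGL, fromBlocks_multiply, two_smul, add_mul]
  have h' := congrArg (K1.mkBlock R N) h
  rw [map_mul, map_mul, map_mul, mul_comm, mul_right_cancel_iff] at h'
  exact left_eq_mul.mp h'

theorem K1.mkBlock_blockLower (a : Matrix (Fin N) (Fin N) R) :
    K1.mkBlock R N (blockLower a) = 1 := by
  have h : blockSwap R N * blockUpper a = blockLower a * blockSwap R N := by
    apply Units.ext
    simp [blockSwap, blockUpper, blockLower, fromBlocks_multiply]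
  have h' := congrArg (K1.mkBlock R N) h
  rwa [map_mul, map_mul, mul_comm, mul_right_cancel_iff, K1.mkBlock_blockUpper, eq_comm] at h'

/-- The classes of `1 + a b` and `1 + b a` in `K₁` agree. -/
theorem K1.mk_one_add_mul_comm (a b : Matrix (Fin N) (Fin N) R) (U V : GL (Fin N) R)
    (hU : (U : Matrix (Fin N) (Fin N) R) = 1 + a * b)
    (hV : (V : Matrix (Fin N) (Fin N) R) = 1 + b * a) : K1.mk U = K1.mk V := by
  -- Both sides are block triangular factorizations of `[[1, a], [-b, 1]]`. The triangular factors
  -- die in `K₁`, which leaves `U` on one side and `V` on the other.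
  have h : blockUpper a * (blockLower (-b * (↑U⁻¹ : Matrix (Fin N) (Fin N) R)) * blockDiag U 1) =
      blockLower (-b) * (blockDiag 1 V * blockUpper a) := by
    apply Units.ext
    have e : b * a = V - 1 := by rw [hV]; abel
    simp [blockUpper, blockLower, blockDiag, fromBlocks_multiply, mul_assoc, hV]
    rw [hU]
    abel
  have h' := congrArg (K1.mkBlock R N) h
  simpa only [map_mul, K1.mkBlock_blockUpper, K1.mkBlock_blockLower, one_mul, mul_one,
    K1.mkBlock_blockDiag_left, K1.mkBlock_blockDiag_right] using h'

end Blocks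

/-! ### Additivity of the trace of the logarithm. -/

section LogTrace

open Polynomial

/-- `∑_{k < m} (-x) ^ k` is the inverse of `1 + x` if `x ^ m = 0`. -/
theorem one_add_mul_geom {S : Type*} [Ring S] {m : ℕ} {x : S} (hx : x ^ m = 0) :
    (1 + x) * ∑ k ∈ Finset.range m, (-x) ^ k = 1 := by
  have h := mul_neg_geom_sum (-x) m
  rwa [sub_neg_eq_add, neg_pow, hx, mul_zero, sub_zero] at h

theorem geom_mul_one_add {S : Type*} [Ring S] {m : ℕ} {x : S} (hx : x ^ m = 0) :
    (∑ k ∈ Finset.range m, (-x) ^ k) * (1 + x) = 1 := by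
  have h := geom_sum_mul_neg (-x) m
  rwa [sub_neg_eq_add, neg_pow, hx, mul_zero, sub_zero] at h

variable {S : Type*} [Ring S] [Algebra ℚ S] {V : Type*} [AddCommGroup V] [Module ℚ V]

/-- The truncation `∑_{k < m} (-1) ^ k / (k + 1) • x ^ (k + 1)` of `log (1 + x)`. -/
def logTrunc (m : ℕ) (x : S) : S :=
  ∑ k ∈ Finset.range m, ((-1 : ℚ) ^ k / ((k : ℚ) + 1)) • x ^ (k + 1)

theorem map_logTrunc {S' : Type*} [Ring S'] [Algebra ℚ S'] (f : S →+* S') (m : ℕ) (x : S) :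
    f (logTrunc m x) = logTrunc m (f x) := by
  simp only [logTrunc, map_sum, map_rat_smul, map_pow]

/-- By Leibniz, the derivative is a sum of words with one factor `p'` and `k` factors `p`, and a
trace allows all `p` to be collected on the left. The extra power `j` stores the factors already
moved during the induction. -/
theorem trace_mul_derivative_pow (T : S[X] →ₗ[ℚ] V) (hT : ∀ a b, T (a * b) = T (b * a)) (p : S[X])
    (k : ℕ) : ∀ j, T (p ^ j * derivative (p ^ (k + 1))) =
      ((k : ℚ) + 1) • T (p ^ (j + k) * derivative p) := by
  induction k with
  | zero => intro j; simp
  | succ k ih =>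
    intro j
    have h : T (p ^ j * (derivative (p ^ (k + 1)) * p)) =
        T (p ^ (j + 1) * derivative (p ^ (k + 1))) := by
      rw [← mul_assoc, hT, ← mul_assoc, ← pow_succ' p j]
    rw [pow_succ _ (k + 1), derivative_mul, mul_add, map_add, h, ih, ← mul_assoc, ← pow_add,
      show j + 1 + k = j + (k + 1) by ring, Nat.cast_succ, add_smul ((k : ℚ) + 1) 1, one_smul]

/-- The linear functional `p ↦ T (coeff i p)`. -/
def coeffTrace (T : S →ₗ[ℚ] V) (i : ℕ) : S[X] →ₗ[ℚ] V where
  toFun p := T (p.coeff i)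
  map_add' p q := by rw [coeff_add, map_add]
  map_smul' r p := by rw [coeff_smul, map_smul]; rfl

theorem coeffTrace_mul_comm (T : S →ₗ[ℚ] V) (hT : ∀ a b, T (a * b) = T (b * a)) (i : ℕ)
    (p q : S[X]) : coeffTrace T i (p * q) = coeffTrace T i (q * p) := by
  change T _ = T _
  rw [coeff_mul, coeff_mul, map_sum, map_sum, ← Finset.Nat.sum_antidiagonal_swap]
  exact Finset.sum_congr rfl fun _ _ => hT _ _

theorem coeffTrace_derivative (T : S →ₗ[ℚ] V) (i : ℕ) (p : S[X]) :
    coeffTrace T i (derivative p) = ((i : ℚ) + 1) • coeffTrace T (i + 1) p := by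
  change T _ = _ • T _
  rw [coeff_derivative, ← map_smul]
  congr 1
  rw [Algebra.smul_def, map_add, map_one, map_natCast, ← Nat.cast_succ, Nat.cast_comm]

/-- This is `(log (1 + p))' = (1 + p)⁻¹ p'` under a trace. It holds term by term for the
truncations; nilpotency only matters later, when the geometric sum has to be an inverse. -/
theorem coeffTrace_succ_logTrunc (T : S →ₗ[ℚ] V) (hT : ∀ a b, T (a * b) = T (b * a)) (m i : ℕ)
    (p : S[X]) : ((i : ℚ) + 1) • coeffTrace T (i + 1) (logTrunc m p) =
      coeffTrace T i ((∑ k ∈ Finset.range m, (-p) ^ k) * derivative p) := by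
  rw [← coeffTrace_derivative, logTrunc, map_sum, map_sum, Finset.sum_mul, map_sum]
  refine Finset.sum_congr rfl fun k _ => ?_
  have h := trace_mul_derivative_pow (coeffTrace T i) (coeffTrace_mul_comm T hT i) p k 0
  rw [pow_zero, one_mul, zero_add] at h
  have hk : (k : ℚ) + 1 ≠ 0 := by positivity
  have h2 : (-p) ^ k = ((-1 : ℚ) ^ k) • p ^ k := by
    rw [neg_pow, Algebra.smul_def, map_pow, map_neg, map_one]
  rw [derivative_smul, map_smul, h, smul_smul, div_mul_cancel₀ _ hk, h2, smul_mul_assoc, map_smul]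

/-- Additivity of the trace of the logarithm, for nilpotent `z = (1 + x X) (1 + y) - 1`. -/
theorem trace_logTrunc_mul (T : S →ₗ[ℚ] V) (hT : ∀ a b, T (a * b) = T (b * a)) (m : ℕ) (x y : S)
    (hx : x ^ m = 0) (hy : y ^ m = 0) (hz : ((1 + X * C x) * (1 + C y) - 1 : S[X]) ^ m = 0) :
    T (logTrunc m ((1 + x) * (1 + y) - 1)) = T (logTrunc m x) + T (logTrunc m y) := by
  -- The deformation replaces `x` by `X x`: `1 + z` runs from `1 + y` at `X = 0` to `(1 + x)(1 + y)`
  -- at `X = 1`. The traces of `log (1 + z)` and `log (1 + w)` have the same derivative in `X`, so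
  -- their difference keeps its value at `X = 0`, the trace of `log (1 + y)`.
  set z : S[X] := (1 + X * C x) * (1 + C y) - 1 with hzdef
  set w : S[X] := X * C x with hwdef
  have hw : w ^ m = 0 := by
    rw [hwdef, (Polynomial.commute_X (C x)).mul_pow, ← C_pow, hx, C_0, mul_zero]
  have hCy : (C y : S[X]) ^ m = 0 := by rw [← C_pow, hy, C_0]
  have hz1 : 1 + z = (1 + w) * (1 + C y) := by rw [hzdef]; abel
  have hzd : derivative z = C x * (1 + C y) := by
    rw [hzdef, hwdef]
    simp
  have hwd : derivative w = C x := by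
    rw [hwdef]
    simp
  have hinv : ∑ k ∈ Finset.range m, (-z) ^ k =
      (∑ k ∈ Finset.range m, (-C y) ^ k) * ∑ k ∈ Finset.range m, (-w) ^ k := by
    refine left_inv_eq_right_inv (geom_mul_one_add hz) ?_
    rw [hz1, mul_assoc, ← mul_assoc (1 + C y), one_add_mul_geom hCy, one_mul, one_add_mul_geom hw]
  -- Here `(1 + z)⁻¹ z' = (1 + y)⁻¹ (1 + w)⁻¹ x (1 + y)`, and cyclicity of the trace cancels the
  -- outer factors, leaving `(1 + w)⁻¹ w'`.
  have hsucc : ∀ i, coeffTrace T (i + 1) (logTrunc m z - logTrunc m w) = 0 := by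
    intro i
    have h : ((i : ℚ) + 1) • coeffTrace T (i + 1) (logTrunc m z) =
        ((i : ℚ) + 1) • coeffTrace T (i + 1) (logTrunc m w) := by
      rw [coeffTrace_succ_logTrunc T hT, coeffTrace_succ_logTrunc T hT, hinv, hzd, hwd, mul_assoc,
        coeffTrace_mul_comm T hT, mul_assoc, mul_assoc, one_add_mul_geom hCy, mul_one]
    rw [map_sub, sub_eq_zero]
    exact smul_right_injective V (show (i : ℚ) + 1 ≠ 0 by positivity) h
  -- Evaluation over a noncommutative ring is multiplicative here because the point `1` is central.
  let ev : S[X] →+* S := eval₂RingHom' (RingHom.id S) 1 fun _ => Commute.one_right _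
  have hev : ∀ p : S[X], T (ev p) = ∑ i ∈ Finset.range (p.natDegree + 1), coeffTrace T i p := by
    intro p
    change T (p.eval 1) = ∑ i ∈ _, T (p.coeff i)
    rw [eval_eq_sum_range, map_sum]
    simp
  have h0 := hev (logTrunc m z - logTrunc m w)
  have evX : ev X = 1 := eval_X
  have evC : ∀ a, ev (C a) = a := fun a => eval_C
  have h1 : T ((logTrunc m z - logTrunc m w).coeff 0) = T (logTrunc m y) := by
    change T (constantCoeff (logTrunc m z - logTrunc m w)) = _
    rw [map_sub, map_logTrunc, map_logTrunc, hzdef, hwdef]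
    simp [logTrunc]
  rw [Finset.sum_range_succ', Finset.sum_eq_zero fun i _ => hsucc i, zero_add] at h0
  change _ = T _ at h0
  rw [h1, map_sub, map_logTrunc, map_logTrunc, map_sub, hzdef, hwdef, map_sub, map_mul, map_add,
    map_add, map_mul, map_one, evX, evC, evC, one_mul] at h0
  rw [← h0]
  abel

end LogTrace

/-! ### Matrices over powers of an ideal, and stabilization. -/

section MatrixIdeals

variable {Q : Type*} [Ring Q] {I : Ideal Q} {N : ℕ}

theorem mul_mem_matrix_pow [I.IsTwoSided] {a b : ℕ} {X Y : Matrix (Fin N) (Fin N) Q}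
    (hX : X ∈ (I ^ a).matrix (Fin N)) (hY : Y ∈ (I ^ b).matrix (Fin N)) :
    X * Y ∈ (I ^ (a + b)).matrix (Fin N) := by
  intro i j
  rw [Matrix.mul_apply]
  refine Ideal.sum_mem _ fun k _ => ?_
  rw [Ideal.IsTwoSided.pow_add]
  exact Ideal.mul_mem_mul (hX i k) (hY k j)

theorem mul_mem_matrix_right {I : Ideal Q} [I.IsTwoSided] {X : Matrix (Fin N) (Fin N) Q}
    (hX : X ∈ I.matrix (Fin N)) (Y : Matrix (Fin N) (Fin N) Q) : X * Y ∈ I.matrix (Fin N) := by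
  intro i j
  rw [Matrix.mul_apply]
  exact Ideal.sum_mem _ fun k _ => Ideal.mul_mem_right _ _ (hX i k)

theorem matrix_pow_anti {a b : ℕ} (h : a ≤ b) {X : Matrix (Fin N) (Fin N) Q}
    (hX : X ∈ (I ^ b).matrix (Fin N)) : X ∈ (I ^ a).matrix (Fin N) :=
  fun i j => Ideal.pow_le_pow_right h (hX i j)

theorem pow_mem_matrix_pow [I.IsTwoSided] {a : ℕ} {X : Matrix (Fin N) (Fin N) Q}
    (hX : X ∈ (I ^ a).matrix (Fin N)) (k : ℕ) : X ^ k ∈ (I ^ (a * k)).matrix (Fin N) := by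
  induction k with
  | zero => intro i j; simp [Submodule.pow_zero, Ideal.one_eq_top]
  | succ k ih => rw [pow_succ, Nat.mul_succ]; exact mul_mem_matrix_pow ih hX

theorem pow_eq_zero_of_mem_matrix [I.IsTwoSided] {m : ℕ} (hm : I ^ m = ⊥)
    {X : Matrix (Fin N) (Fin N) Q} (hX : X ∈ I.matrix (Fin N)) : X ^ m = 0 := by
  have h := pow_mem_matrix_pow (I := I) (a := 1) (by rwa [Submodule.pow_one]) m (X := X)
  rw [one_mul, hm] at h
  ext i j
  exact h i j

-- All coefficients of the deformation lie in the matrices over `I`, so those of its `m`-th power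
-- lie over `I ^ m = 0`. This supplies the nilpotency that `trace_logTrunc_mul` needs.
open Polynomial in
theorem polynomial_pow_eq_zero [I.IsTwoSided] {m : ℕ} (hm : I ^ m = ⊥)
    {x y : Matrix (Fin N) (Fin N) Q} (hx : x ∈ I.matrix (Fin N)) (hy : y ∈ I.matrix (Fin N)) :
    ((1 + X * C x) * (1 + C y) - 1 : (Matrix (Fin N) (Fin N) Q)[X]) ^ m = 0 := by
  set z : (Matrix (Fin N) (Fin N) Q)[X] := (1 + X * C x) * (1 + C y) - 1 with hz
  have h1 : ∀ i, z.coeff i ∈ I.matrix (Fin N) := by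
    intro i
    have e : z = X * C (x * (1 + y)) + C y := by
      rw [hz, C_mul, C_add, C_1]
      noncomm_ring
    rw [e, coeff_add]
    refine Ideal.add_mem _ ?_ ?_
    · cases i with
      | zero => rw [coeff_X_mul_zero]; exact Ideal.zero_mem _
      | succ i =>
        rw [coeff_X_mul, coeff_C]
        split_ifs
        · exact mul_mem_matrix_right hx _
        · exact Ideal.zero_mem _
    · rw [coeff_C]
      split_ifs
      · exact hy
      · exact Ideal.zero_mem _
  have h2 : ∀ k i, (z ^ k).coeff i ∈ (I ^ k).matrix (Fin N) := by
    intro k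
    induction k with
    | zero => intro i _ _; simp [Submodule.pow_zero, Ideal.one_eq_top]
    | succ k ih =>
      intro i
      rw [pow_succ, coeff_mul]
      refine Ideal.sum_mem _ fun p _ => mul_mem_matrix_pow (ih _) ?_
      rw [Submodule.pow_one]
      exact h1 _
  ext i a b
  have h := h2 m i a b
  rw [hm] at h
  exact h

/-- The `N × M` matrix with ones on the diagonal. -/
def diagInclusion (Q : Type*) [Ring Q] (N M : ℕ) : Matrix (Fin N) (Fin M) Q :=
  Matrix.of fun i j => if (i : ℕ) = j then 1 else 0

theorem diagInclusion_mul_transpose {N M : ℕ} (h : N ≤ M) :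
    diagInclusion Q N M * (diagInclusion Q N M).transpose = 1 := by
  ext i j
  rw [Matrix.mul_apply, Finset.sum_eq_single (Fin.castLE h i)]
  · simp [diagInclusion, Matrix.one_apply, Fin.ext_iff, eq_comm]
  · intro k _ hk
    have : (i : ℕ) ≠ k := fun e => hk (Fin.ext e.symm)
    simp [diagInclusion, this]
  · simp

/-- With `P` the inclusion matrix, `P Pᵀ = 1`. Powers of `Pᵀ (B - 1) P` are therefore `Pᵀ (B - 1) ^
k P` for `k ≥ 1`, and their traces reduce to those of `(B - 1) ^ k` by cyclicity. -/
theorem stab_sub_one {N M : ℕ} (h : N ≤ M) (B : GL (Fin N) Q) :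
    (stab Q N M h B : Matrix (Fin M) (Fin M) Q) - 1 =
      (diagInclusion Q N M).transpose * (((B : Matrix (Fin N) (Fin N) Q) - 1) *
        diagInclusion Q N M) := by
  have key : ∀ (X : Matrix (Fin N) (Fin N) Q) (i j : Fin M),
      ((diagInclusion Q N M).transpose * (X * diagInclusion Q N M)) i j =
        if hij : (i : ℕ) < N ∧ (j : ℕ) < N then X ⟨i, hij.1⟩ ⟨j, hij.2⟩ else 0 := by
    intro X i j
    have hP : ∀ (k : Fin N) (l : Fin M), diagInclusion Q N M k l = if (k : ℕ) = l then 1 else 0 :=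
      fun _ _ => rfl
    simp only [Matrix.mul_apply, Matrix.transpose_apply, hP]
    by_cases hi : (i : ℕ) < N
    · rw [Finset.sum_eq_single ⟨i, hi⟩]
      · by_cases hj : (j : ℕ) < N
        · rw [Finset.sum_eq_single ⟨j, hj⟩]
          · simp [hi, hj]
          · intro k _ hk
            rw [if_neg fun e => hk (Fin.ext e), mul_zero]
          · simp
        · rw [Finset.sum_eq_zero]
          · simp [hj]
          · intro k _
            rw [if_neg (by omega), mul_zero]
      · intro k _ hk
        rw [if_neg fun e => hk (Fin.ext e), zero_mul]
      · simp
    · rw [Finset.sum_eq_zero]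
      · simp [hi]
      · intro k _
        rw [if_neg (by omega), zero_mul]
  ext i j
  rw [key, Matrix.sub_apply]
  change blockOneFun _ i j - _ = _
  rw [blockOneFun_apply]
  by_cases hij : (i : ℕ) < N ∧ (j : ℕ) < N
  · simp [hij, Matrix.one_apply, Fin.ext_iff]
  · simp [hij, Matrix.one_apply]

end MatrixIdeals

/-! ### The trace of the logarithm as a homomorphism on `K₁`. -/

section KOneLog

variable {Q : Type*} [Ring Q] [Algebra ℚ Q] {V : Type*} [AddCommGroup V] [Module ℚ V]

/-- The functional `X ↦ τ (tr X)` on matrices. -/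
def matTrace (τ : Q →ₗ[ℚ] V) (N : ℕ) : Matrix (Fin N) (Fin N) Q →ₗ[ℚ] V :=
  τ ∘ₗ Matrix.traceLinearMap (Fin N) ℚ Q

theorem matTrace_apply (τ : Q →ₗ[ℚ] V) {N : ℕ} (X : Matrix (Fin N) (Fin N) Q) :
    matTrace τ N X = τ X.trace := rfl

theorem map_trace_mul_comm (τ : Q →ₗ[ℚ] V) (hτ : ∀ a b, τ (a * b) = τ (b * a)) {N M : ℕ}
    (X : Matrix (Fin N) (Fin M) Q) (Y : Matrix (Fin M) (Fin N) Q) :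
    τ (X * Y).trace = τ (Y * X).trace := by
  simp only [Matrix.trace, Matrix.diag, Matrix.mul_apply, map_sum]
  rw [Finset.sum_comm]
  exact Finset.sum_congr rfl fun _ _ => Finset.sum_congr rfl fun _ _ => hτ _ _

theorem logMatrix_one_add {N m : ℕ} {X : Matrix (Fin N) (Fin N) Q} (hX : X ^ m = 0) :
    logMatrix (1 + X) = logTrunc m X := by
  rw [logMatrix, logTrunc]
  simp only [add_sub_cancel_left]
  refine finsum_eq_sum_of_support_subset _ fun k hk => ?_
  by_contra hk'
  rw [Finset.mem_coe, Finset.mem_range, not_lt] at hk'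
  exact hk (by simp only [pow_eq_zero_of_le (show m ≤ k + 1 by omega) hX, smul_zero])

variable (ε : Q →ₐ[ℚ] ℚ)

theorem normalized_sub_one_mem_matrix {N : ℕ} (A : GL (Fin N) Q) :
    (normalized ε A : Matrix (Fin N) (Fin N) Q) - 1 ∈ (augIdeal ε).matrix (Fin N) :=
  fun i j => normalized_sub_one_mem ε A i j

theorem logMatrix_normalized {m : ℕ} (hm : augIdeal ε ^ m = ⊥) {N : ℕ} (A : GL (Fin N) Q) :
    logMatrix (normalized ε A : Matrix (Fin N) (Fin N) Q) =
      logTrunc m ((normalized ε A : Matrix (Fin N) (Fin N) Q) - 1) := by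
  rw [← logMatrix_one_add (pow_eq_zero_of_mem_matrix hm (normalized_sub_one_mem_matrix ε A)),
    add_sub_cancel]

/-- Normalization is multiplicative only up to conjugation by `ε(A)`, which the trace of the
logarithm does not see. -/
theorem normalized_mul {N : ℕ} (A B : GL (Fin N) Q) :
    normalized ε (A * B) = normalized ε A * (glMap (algebraMap ℚ Q) N (glMap (ε : Q →+* ℚ) N A) *
      normalized ε B * (glMap (algebraMap ℚ Q) N (glMap (ε : Q →+* ℚ) N A))⁻¹) := by
  simp only [normalized, map_mul, mul_inv_rev]
  group

theorem matTrace_logTrunc_conj (τ : Q →ₗ[ℚ] V) (hτ : ∀ a b, τ (a * b) = τ (b * a)) {N : ℕ} (m : ℕ)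
    (U : GL (Fin N) Q) (X : Matrix (Fin N) (Fin N) Q) :
    matTrace τ N (logTrunc m (U * X * (↑U⁻¹ : Matrix (Fin N) (Fin N) Q))) =
      matTrace τ N (logTrunc m X) := by
  rw [logTrunc, logTrunc, map_sum, map_sum]
  refine Finset.sum_congr rfl fun k _ => ?_
  rw [Units.conj_pow, map_smul, map_smul, matTrace_apply, map_trace_mul_comm τ hτ, ← mul_assoc,
    Units.inv_mul, one_mul, matTrace_apply]

theorem matTrace_log_normalized_mul {m : ℕ} (hm : augIdeal ε ^ m = ⊥) (τ : Q →ₗ[ℚ] V)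
    (hτ : ∀ a b, τ (a * b) = τ (b * a)) {N : ℕ} (A B : GL (Fin N) Q) :
    matTrace τ N (logMatrix (normalized ε (A * B) : Matrix (Fin N) (Fin N) Q)) =
      matTrace τ N (logMatrix (normalized ε A : Matrix (Fin N) (Fin N) Q)) +
        matTrace τ N (logMatrix (normalized ε B : Matrix (Fin N) (Fin N) Q)) := by
  set U := glMap (algebraMap ℚ Q) N (glMap (ε : Q →+* ℚ) N A) with hU
  set x := (normalized ε A : Matrix (Fin N) (Fin N) Q) - 1 with hx
  set y := (normalized ε B : Matrix (Fin N) (Fin N) Q) - 1 with hy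
  have hxJ : x ∈ (augIdeal ε).matrix (Fin N) := normalized_sub_one_mem_matrix ε A
  have hyJ : U * y * (↑U⁻¹ : Matrix (Fin N) (Fin N) Q) ∈ (augIdeal ε).matrix (Fin N) :=
    mul_mem_matrix_right (Ideal.mul_mem_left _ _ (normalized_sub_one_mem_matrix ε B)) _
  have h := trace_logTrunc_mul (matTrace τ N) (fun a b => map_trace_mul_comm τ hτ a b) m x
    (U * y * (↑U⁻¹ : Matrix (Fin N) (Fin N) Q)) (pow_eq_zero_of_mem_matrix hm hxJ)
    (pow_eq_zero_of_mem_matrix hm hyJ) (polynomial_pow_eq_zero hm hxJ hyJ)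
  have e : (normalized ε (A * B) : Matrix (Fin N) (Fin N) Q) - 1 =
      (1 + x) * (1 + U * y * (↑U⁻¹ : Matrix (Fin N) (Fin N) Q)) - 1 := by
    rw [normalized_mul, hx, hy, mul_sub, sub_mul, mul_one, Units.mul_inv, add_sub_cancel,
      add_sub_cancel]
    rfl
  rw [logMatrix_normalized ε hm, logMatrix_normalized ε hm, logMatrix_normalized ε hm, e, h,
    matTrace_logTrunc_conj τ hτ]

theorem normalized_stab {N M : ℕ} (h : N ≤ M) (A : GL (Fin N) Q) :
    normalized ε (stab Q N M h A) = stab Q N M h (normalized ε A) := by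
  rw [normalized, normalized, map_mul, map_inv, glMap_stab, glMap_stab]

theorem matTrace_log_normalized_stab {m : ℕ} (hm : augIdeal ε ^ m = ⊥) (τ : Q →ₗ[ℚ] V)
    (hτ : ∀ a b, τ (a * b) = τ (b * a)) {N M : ℕ} (h : N ≤ M) (A : GL (Fin N) Q) :
    matTrace τ M (logMatrix (normalized ε (stab Q N M h A) : Matrix (Fin M) (Fin M) Q)) =
      matTrace τ N (logMatrix (normalized ε A : Matrix (Fin N) (Fin N) Q)) := by
  rw [logMatrix_normalized ε hm, logMatrix_normalized ε hm, normalized_stab, stab_sub_one, logTrunc,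
    logTrunc, map_sum, map_sum]
  refine Finset.sum_congr rfl fun k hk => ?_
  clear hk
  generalize (normalized ε A : Matrix (Fin N) (Fin N) Q) - 1 = X
  have hpow : ((diagInclusion Q N M).transpose * (X * diagInclusion Q N M)) ^ (k + 1) =
      (diagInclusion Q N M).transpose * (X ^ (k + 1) * diagInclusion Q N M) := by
    induction k with
    | zero => rw [zero_add, pow_one, pow_one]
    | succ k ih =>
      rw [pow_succ, ih, pow_succ X (k + 1)]
      simp only [Matrix.mul_assoc]
      rw [← Matrix.mul_assoc (diagInclusion Q N M) (diagInclusion Q N M).transpose,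
        diagInclusion_mul_transpose h, Matrix.one_mul]
  rw [hpow, map_smul, map_smul, matTrace_apply, matTrace_apply, map_trace_mul_comm τ hτ,
    Matrix.mul_assoc, diagInclusion_mul_transpose h, Matrix.mul_one]

/-- For an augmented `ℚ`-algebra `Q` with nilpotent augmentation ideal, and a linear functional `τ`
that vanishes on commutators, the homomorphism `A ↦ τ (tr (log (A ε(A)⁻¹)))` on `K₁(Q)`. -/
def K1.logTrace {m : ℕ} (hm : augIdeal ε ^ m = ⊥) (τ : Q →ₗ[ℚ] V)
    (hτ : ∀ a b, τ (a * b) = τ (b * a)) : K1 Q →* Multiplicative V :=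
  K1.lift (fun N => MonoidHom.mk' (fun A => Multiplicative.ofAdd
      (matTrace τ N (logMatrix (normalized ε A : Matrix (Fin N) (Fin N) Q))))
      fun A B => by rw [matTrace_log_normalized_mul ε hm τ hτ, ofAdd_add])
    fun N M h A => congrArg Multiplicative.ofAdd (matTrace_log_normalized_stab ε hm τ hτ h A)

theorem K1.logTrace_mk {m : ℕ} (hm : augIdeal ε ^ m = ⊥) (τ : Q →ₗ[ℚ] V)
    (hτ : ∀ a b, τ (a * b) = τ (b * a)) {N : ℕ} (A : GL (Fin N) Q) :
    K1.logTrace ε hm τ hτ (K1.mk A) = Multiplicative.ofAdd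
      (τ (logMatrix (normalized ε A : Matrix (Fin N) (Fin N) Q)).trace) := rfl

/-- Naturality of `K1.logTrace`. -/
theorem K1.logTrace_map {Q' : Type*} [Ring Q'] [Algebra ℚ Q'] (ε' : Q' →ₐ[ℚ] ℚ) (f : Q →ₐ[ℚ] Q')
    (hf : ∀ x, ε' (f x) = ε x) {m : ℕ} (hm : augIdeal ε ^ m = ⊥) (hm' : augIdeal ε' ^ m = ⊥)
    (τ : Q' →ₗ[ℚ] V) (hτ : ∀ a b, τ (a * b) = τ (b * a)) (z : K1 Q) :
    K1.logTrace ε hm (τ ∘ₗ f.toLinearMap) (fun a b => by simp [hτ]) z =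
      K1.logTrace ε' hm' τ hτ (K1.map (f : Q →+* Q') z) := by
  obtain ⟨N, A, rfl⟩ := K1.mk_surjective z
  rw [K1.map_mk, K1.logTrace_mk, K1.logTrace_mk, logMatrix_normalized ε hm,
    logMatrix_normalized ε' hm']
  have hn : normalized ε' (glMap (f : Q →+* Q') N A) = glMap (f : Q →+* Q') N (normalized ε A) := by
    rw [normalized, normalized, map_mul, map_inv]
    congr 2
    apply Units.ext
    ext i j
    simp [glMap, hf]
  rw [hn]
  have h1 : ((glMap (f : Q →+* Q') N (normalized ε A) : GL (Fin N) Q') :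
      Matrix (Fin N) (Fin N) Q') - 1 = (f : Q →+* Q').mapMatrix
        ((normalized ε A : Matrix (Fin N) (Fin N) Q) - 1) := by
    rw [map_sub, map_one]
    rfl
  rw [h1, ← map_logTrunc]
  congr 1
  simp [Matrix.trace, map_sum]

end KOneLog

/-! ### The filtration of `K₁` by congruence modulo powers of an ideal. -/

section CongruenceFiltration

variable {Q : Type*} [Ring Q] {N : ℕ}

open Classical in
/-- The class in `K₁(Q)` of a square matrix, with the value `1` if it is not invertible. -/
def K1.ofMat (B : Matrix (Fin N) (Fin N) Q) : K1 Q :=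
  if h : IsUnit B then K1.mk h.unit else 1

theorem K1.ofMat_coe (A : GL (Fin N) Q) : K1.ofMat (A : Matrix (Fin N) (Fin N) Q) = K1.mk A := by
  rw [K1.ofMat, dif_pos A.isUnit]
  congr 1
  exact Units.ext rfl

theorem K1.ofMat_one : K1.ofMat (1 : Matrix (Fin N) (Fin N) Q) = 1 := by
  rw [← Units.val_one, K1.ofMat_coe, K1.mk_one]

theorem K1.ofMat_mul {A B : Matrix (Fin N) (Fin N) Q} (hA : IsUnit A) (hB : IsUnit B) :
    K1.ofMat (A * B) = K1.ofMat A * K1.ofMat B := by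
  obtain ⟨A, rfl⟩ := hA
  obtain ⟨B, rfl⟩ := hB
  rw [← Units.val_mul, K1.ofMat_coe, K1.ofMat_coe, K1.ofMat_coe, K1.mk_mul]

theorem K1.ofMat_one_add_mul_comm [Algebra ℚ Q] {a b : Matrix (Fin N) (Fin N) Q}
    (h : IsUnit (1 + a * b)) (h' : IsUnit (1 + b * a)) :
    K1.ofMat (1 + a * b) = K1.ofMat (1 + b * a) := by
  obtain ⟨U, hU⟩ := h
  obtain ⟨V, hV⟩ := h'
  rw [← hU, ← hV, K1.ofMat_coe, K1.ofMat_coe, K1.mk_one_add_mul_comm a b U V hU hV]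

variable {I : Ideal Q} [I.IsTwoSided] {m : ℕ}

theorem isUnit_one_add (hm : I ^ m = ⊥) {X : Matrix (Fin N) (Fin N) Q}
    (hX : X ∈ I.matrix (Fin N)) : IsUnit (1 + X) :=
  have h := pow_eq_zero_of_mem_matrix hm hX
  ⟨⟨1 + X, _, one_add_mul_geom h, geom_mul_one_add h⟩, rfl⟩

theorem mem_matrix_of_mem_pow_succ {I : Ideal Q} {k : ℕ} {X : Matrix (Fin N) (Fin N) Q}
    (hX : X ∈ (I ^ (k + 1)).matrix (Fin N)) : X ∈ I.matrix (Fin N) :=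
  fun i j => Ideal.pow_le_self (Nat.succ_ne_zero k) (hX i j)

/-- The subgroup of `K₁(Q)` of the classes of the `N × N` matrices congruent to `1` modulo
`I ^ (k + 1)`. -/
def K1.congr (hm : I ^ m = ⊥) (N k : ℕ) : Subgroup (K1 Q) where
  carrier := {z | ∃ X ∈ (I ^ (k + 1)).matrix (Fin N), K1.ofMat (1 + X) = z}
  one_mem' := ⟨0, Ideal.zero_mem _, by rw [add_zero, K1.ofMat_one]⟩
  mul_mem' := by
    rintro _ _ ⟨X, hX, rfl⟩ ⟨Y, hY, rfl⟩
    refine ⟨X + Y + X * Y, Ideal.add_mem _ (Ideal.add_mem _ hX hY) (Ideal.mul_mem_left _ _ hY), ?_⟩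
    rw [← K1.ofMat_mul (isUnit_one_add hm (mem_matrix_of_mem_pow_succ hX))
      (isUnit_one_add hm (mem_matrix_of_mem_pow_succ hY))]
    congr 1
    noncomm_ring
  inv_mem' := by
    rintro _ ⟨X, hX, rfl⟩
    obtain ⟨U, hU⟩ := isUnit_one_add hm (mem_matrix_of_mem_pow_succ hX)
    refine ⟨-((↑U⁻¹ : Matrix (Fin N) (Fin N) Q) * X), neg_mem (Ideal.mul_mem_left _ _ hX), ?_⟩
    have h : 1 + -((↑U⁻¹ : Matrix (Fin N) (Fin N) Q) * X) = ↑U⁻¹ := by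
      rw [← sub_eq_add_neg, show X = U - 1 by rw [hU]; abel, mul_sub, Units.inv_mul, mul_one]
      abel
    rw [h, ← hU, K1.ofMat_coe, K1.ofMat_coe, K1.mk_inv]

theorem K1.ofMat_mem_congr (hm : I ^ m = ⊥) {k : ℕ} {X : Matrix (Fin N) (Fin N) Q}
    (hX : X ∈ (I ^ (k + 1)).matrix (Fin N)) : K1.ofMat (1 + X) ∈ K1.congr hm N k := ⟨X, hX, rfl⟩

/-- The quotient is explicit: `1 + X = (1 + Y)(1 + (1 + Y)⁻¹(X - Y))`. Terms of higher order can
thus be dropped without leaving the subgroup. -/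
theorem K1.ofMat_div_mem_congr (hm : I ^ m = ⊥) {k : ℕ} {X Y : Matrix (Fin N) (Fin N) Q}
    (hY : Y ∈ I.matrix (Fin N)) (hXY : X - Y ∈ (I ^ (k + 1)).matrix (Fin N)) :
    K1.ofMat (1 + X) / K1.ofMat (1 + Y) ∈ K1.congr hm N k := by
  obtain ⟨U, hU⟩ := isUnit_one_add hm hY
  have h1 : (↑U⁻¹ : Matrix (Fin N) (Fin N) Q) * (X - Y) ∈ (I ^ (k + 1)).matrix (Fin N) :=
    Ideal.mul_mem_left _ _ hXY
  have h2 : 1 + X = (1 + Y) * (1 + (↑U⁻¹ : Matrix (Fin N) (Fin N) Q) * (X - Y)) := by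
    rw [← hU, mul_add, mul_one, Units.mul_inv_cancel_left, hU]
    abel
  rw [h2, K1.ofMat_mul ⟨U, hU⟩ (isUnit_one_add hm (mem_matrix_of_mem_pow_succ h1)),
    mul_div_cancel_left]
  exact K1.ofMat_mem_congr hm h1

theorem K1.congr_eq_one (hm : I ^ m = ⊥) {k : ℕ} (hk : m ≤ k + 1) {z : K1 Q}
    (hz : z ∈ K1.congr hm N k) : z = 1 := by
  obtain ⟨X, hX, rfl⟩ := hz
  have h0 : X = 0 := by
    ext i j
    have h := Ideal.pow_le_pow_right hk (hX i j)
    rw [hm] at h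
    exact h
  rw [h0, add_zero, K1.ofMat_one]

/-- The matrices `X` with entries in `I ^ (k + 1)` such that `1 + X` has the same class in
`K₁(Q)` as a matrix congruent to `1` modulo `I ^ (k + 2)`. -/
def congrStep (hm : I ^ m = ⊥) (N k : ℕ) : AddSubmonoid (Matrix (Fin N) (Fin N) Q) where
  carrier := {X | X ∈ (I ^ (k + 1)).matrix (Fin N) ∧ K1.ofMat (1 + X) ∈ K1.congr hm N (k + 1)}
  zero_mem' := ⟨Ideal.zero_mem _, by rw [add_zero, K1.ofMat_one]; exact one_mem _⟩
  add_mem' := by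
    rintro X Y ⟨hX, hX'⟩ ⟨hY, hY'⟩
    refine ⟨Ideal.add_mem _ hX hY, ?_⟩
    have h1 := isUnit_one_add hm (mem_matrix_of_mem_pow_succ hX)
    have h2 := isUnit_one_add hm (mem_matrix_of_mem_pow_succ hY)
    -- The product `(1 + X)(1 + Y)` differs from `1 + X + Y` by `XY`, which has entries in `I ^ (2k
    -- + 2)` and is negligible modulo `I ^ (k + 2)`.
    have h3 : K1.ofMat (1 + (X + Y + X * Y)) = K1.ofMat (1 + X) * K1.ofMat (1 + Y) := by
      rw [← K1.ofMat_mul h1 h2]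
      congr 1
      noncomm_ring
    have h4 : K1.ofMat (1 + (X + Y + X * Y)) ∈ K1.congr hm N (k + 1) := h3 ▸ mul_mem hX' hY'
    have h5 : K1.ofMat (1 + (X + Y)) / K1.ofMat (1 + (X + Y + X * Y)) ∈ K1.congr hm N (k + 1) := by
      refine K1.ofMat_div_mem_congr hm ?_ ?_
      · exact mem_matrix_of_mem_pow_succ
          (Ideal.add_mem _ (Ideal.add_mem _ hX hY) (Ideal.mul_mem_left _ _ hY))
      · rw [sub_add_cancel_left]
        exact neg_mem (matrix_pow_anti (by omega) (mul_mem_matrix_pow hX hY))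
    have h6 := mul_mem h5 h4
    rwa [div_mul_cancel] at h6

/-- One has `(1 + [a, b])(1 + ba) = 1 + ab + [a, b]ba`, where the last term has order `2k + 2`.
Comparing with `1 + ab`, which has the class of `1 + ba`, leaves a class of the next step. Only the
products need to lie in `I ^ (k + 1)`, so one factor may be a matrix unit. -/
theorem commutator_mem_congrStep [Algebra ℚ Q] (hm : I ^ m = ⊥) {k : ℕ}
    {a b : Matrix (Fin N) (Fin N) Q} (hab : a * b ∈ (I ^ (k + 1)).matrix (Fin N))
    (hba : b * a ∈ (I ^ (k + 1)).matrix (Fin N)) : a * b - b * a ∈ congrStep hm N k := by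
  have hX := sub_mem hab hba
  refine ⟨hX, ?_⟩
  have h1 := isUnit_one_add hm (mem_matrix_of_mem_pow_succ hX)
  have h2 := isUnit_one_add hm (mem_matrix_of_mem_pow_succ hba)
  have h3 : K1.ofMat (1 + (a * b + (a * b - b * a) * (b * a))) =
      K1.ofMat (1 + (a * b - b * a)) * K1.ofMat (1 + b * a) := by
    rw [← K1.ofMat_mul h1 h2]
    congr 1
    noncomm_ring
  have h4 : K1.ofMat (1 + (a * b + (a * b - b * a) * (b * a))) / K1.ofMat (1 + a * b) ∈
      K1.congr hm N (k + 1) := by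
    refine K1.ofMat_div_mem_congr hm (mem_matrix_of_mem_pow_succ hab) ?_
    rw [add_sub_cancel_left]
    exact matrix_pow_anti (by omega) (mul_mem_matrix_pow hX hba)
  rwa [h3, K1.ofMat_one_add_mul_comm
    (isUnit_one_add hm (mem_matrix_of_mem_pow_succ hab)) h2, mul_div_cancel_right] at h4

theorem single_mem_matrix {I : Ideal Q} {x : Q} (hx : x ∈ I) (i j : Fin N) :
    Matrix.single i j x ∈ I.matrix (Fin N) := by
  intro i' j'
  rw [Matrix.single_apply]
  split_ifs
  · exact hx
  · exact Ideal.zero_mem _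

/-- Off-diagonal entries are commutators, `E_ij(x) = [E_ii, E_ij(x)]`, and diagonal entries can be
moved to one corner, `E_ii(x) - E_00(x) = [E_i0, E_0i(x)]`. Only the trace in the corner remains;
there `s` contributes commutators and `t` has higher order. -/
theorem mem_congrStep_of_trace [Algebra ℚ Q] (hm : I ^ m = ⊥) {k : ℕ}
    {X : Matrix (Fin N) (Fin N) Q} (hX : X ∈ (I ^ (k + 1)).matrix (Fin N)) {s t : Q}
    (hs : s ∈ Submodule.span ℚ {z : Q | ∃ a b : Q, a * b ∈ I ^ (k + 1) ∧ b * a ∈ I ^ (k + 1) ∧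
      z = a * b - b * a}) (ht : t ∈ I ^ (k + 2)) (hst : X.trace = s + t) :
    K1.ofMat (1 + X) ∈ K1.congr hm N (k + 1) := by
  suffices h : X ∈ congrStep hm N k from h.2
  cases N with
  | zero => rw [Subsingleton.elim X 0]; exact zero_mem _
  | succ N =>
  have hoff : ∀ i j : Fin (N + 1), i ≠ j → ∀ x ∈ I ^ (k + 1),
      Matrix.single i j x ∈ congrStep hm (N + 1) k := by
    intro i j hij x hx
    have h := commutator_mem_congrStep hm (a := Matrix.single i i (1 : Q))
      (b := Matrix.single i j x) (k := k)
      (by rw [Matrix.single_mul_single_same, one_mul]; exact single_mem_matrix hx _ _)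
      (by rw [Matrix.single_mul_single_of_ne _ _ _ _ hij.symm]; exact Ideal.zero_mem _)
    rwa [Matrix.single_mul_single_same, one_mul, Matrix.single_mul_single_of_ne _ _ _ _ hij.symm,
      sub_zero] at h
  have hdiag : ∀ i : Fin (N + 1), ∀ x ∈ I ^ (k + 1),
      Matrix.single i i x - Matrix.single 0 0 x ∈ congrStep hm (N + 1) k := by
    intro i x hx
    have h := commutator_mem_congrStep hm (a := Matrix.single i 0 (1 : Q))
      (b := Matrix.single 0 i x) (k := k)
      (by rw [Matrix.single_mul_single_same, one_mul]; exact single_mem_matrix hx _ _)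
      (by rw [Matrix.single_mul_single_same, mul_one]; exact single_mem_matrix hx _ _)
    rwa [Matrix.single_mul_single_same, one_mul, Matrix.single_mul_single_same, mul_one] at h
  have hzero : Matrix.single 0 0 X.trace ∈ congrStep hm (N + 1) k := by
    rw [hst, Matrix.single_add]
    refine add_mem ?_ ?_
    -- `congrStep` is only an additive submonoid, so the induction over the span carries an
    -- arbitrary scalar, absorbed into the first factor of each commutator.
    · suffices h : ∀ c : ℚ, Matrix.single 0 0 (c • s) ∈ congrStep hm (N + 1) k by
        simpa using h 1
      clear hst
      induction hs using Submodule.span_induction with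
      | mem x hx =>
        intro c
        obtain ⟨a, b, hab, hba, rfl⟩ := hx
        have hsub : ∀ x y : Q, Matrix.single (0 : Fin (N + 1)) (0 : Fin (N + 1)) (x - y) =
            Matrix.single 0 0 x - Matrix.single 0 0 y :=
          map_sub (Matrix.singleAddMonoidHom (0 : Fin (N + 1)) (0 : Fin (N + 1)))
        have h := commutator_mem_congrStep hm (a := Matrix.single (0 : Fin (N + 1)) 0 (c • a))
          (b := Matrix.single 0 0 b) (k := k)
          (by
            rw [Matrix.single_mul_single_same, smul_mul_assoc]
            refine single_mem_matrix ?_ _ _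
            rw [Algebra.smul_def]
            exact Ideal.mul_mem_left _ _ hab)
          (by
            rw [Matrix.single_mul_single_same, mul_smul_comm]
            refine single_mem_matrix ?_ _ _
            rw [Algebra.smul_def]
            exact Ideal.mul_mem_left _ _ hba)
        rwa [Matrix.single_mul_single_same, Matrix.single_mul_single_same, smul_mul_assoc,
          mul_smul_comm, ← hsub, ← smul_sub] at h
      | zero => intro c; rw [smul_zero, Matrix.single_zero]; exact zero_mem _
      | add x y _ _ hx hy => intro c; rw [smul_add, Matrix.single_add]; exact add_mem (hx c) (hy c)
      | smul r x _ hx => intro c; rw [smul_smul]; exact hx _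
    · have h := single_mem_matrix ht (0 : Fin (N + 1)) 0
      exact ⟨matrix_pow_anti (by omega) h, K1.ofMat_mem_congr hm h⟩
  have hsum : X = ∑ i, (∑ j, (if i = j then Matrix.single i i (X i i) - Matrix.single 0 0 (X i i)
      else Matrix.single i j (X i j))) + Matrix.single 0 0 X.trace := by
    have h1 : ∀ i j, (if i = j then Matrix.single i i (X i i) - Matrix.single 0 0 (X i i)
        else Matrix.single i j (X i j)) =
          Matrix.single i j (X i j) - (if i = j then Matrix.single 0 0 (X i i) else 0) := by
      intro i j
      split_ifs with h
      · rw [h]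
      · rw [sub_zero]
    simp only [h1, Finset.sum_sub_distrib, Finset.sum_ite_eq, Finset.mem_univ, if_true]
    rw [← Matrix.matrix_eq_sum_single X, Matrix.trace]
    have h2 : Matrix.single (0 : Fin (N + 1)) (0 : Fin (N + 1)) (∑ i, X.diag i) =
        ∑ i, Matrix.single 0 0 (X i i) :=
      map_sum (Matrix.singleAddMonoidHom (0 : Fin (N + 1)) (0 : Fin (N + 1))) _ _
    rw [h2, sub_add_cancel]
  rw [hsum]
  refine add_mem (sum_mem fun i _ => sum_mem fun j _ => ?_) hzero
  split_ifs with h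
  · exact hdiag i _ (hX i i)
  · exact hoff i j h _ (hX i j)

end CongruenceFiltration

/-! ### The leading term of the trace of the logarithm. -/

section LogTraceCongr

variable {Q : Type*} [Ring Q] [Algebra ℚ Q] {V : Type*} [AddCommGroup V] [Module ℚ V]
  (ε : Q →ₐ[ℚ] ℚ)

theorem normalized_eq_self {N : ℕ} {A : GL (Fin N) Q}
    (hA : (A : Matrix (Fin N) (Fin N) Q) - 1 ∈ (augIdeal ε).matrix (Fin N)) :
    normalized ε A = A := by
  have h : glMap (ε : Q →+* ℚ) N A = 1 := by
    apply Units.ext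
    ext i j
    have h1 : ε (((A : Matrix (Fin N) (Fin N) Q) - 1) i j) = 0 := hA i j
    rw [Matrix.sub_apply, map_sub, sub_eq_zero] at h1
    change ε _ = _
    rw [h1, Matrix.one_apply, Units.val_one, Matrix.one_apply]
    split_ifs <;> simp
  rw [normalized, h, map_one, inv_one, mul_one]

/-- The leading term of `K1.logTrace`. -/
theorem K1.logTrace_ofMat {m : ℕ} (hm : augIdeal ε ^ m = ⊥) (τ : Q →ₗ[ℚ] V)
    (hτ : ∀ a b, τ (a * b) = τ (b * a)) {N k : ℕ} (hk : ∀ x ∈ augIdeal ε ^ (k + 2), τ x = 0)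
    {X : Matrix (Fin N) (Fin N) Q} (hX : X ∈ (augIdeal ε ^ (k + 1)).matrix (Fin N)) :
    K1.logTrace ε hm τ hτ (K1.ofMat (1 + X)) = Multiplicative.ofAdd (τ X.trace) := by
  have hX1 := mem_matrix_of_mem_pow_succ hX
  obtain ⟨U, hU⟩ := isUnit_one_add hm hX1
  have hU1 : (U : Matrix (Fin N) (Fin N) Q) - 1 = X := by rw [hU]; abel
  rw [← hU, K1.ofMat_coe, K1.logTrace_mk, normalized_eq_self ε (by rwa [hU1]), hU,
    -- One term more than necessary, so that the linear term can be split off even for `m = 0`.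
    logMatrix_one_add (m := m + 1)
      (by rw [pow_succ, pow_eq_zero_of_mem_matrix hm hX1, zero_mul]),
    logTrunc, Finset.sum_range_succ']
  rw [Matrix.trace_add, map_add, Matrix.trace_sum, map_sum, Finset.sum_eq_zero, zero_add]
  · simp
  -- Higher terms have entries in `I ^ ((k + 1)(i + 2))`, and `(k + 1)(i + 2) ≥ k + 2`.
  · intro i _
    rw [Matrix.trace_smul, map_smul, hk, smul_zero]
    refine Ideal.sum_mem _ fun a _ => ?_
    refine Ideal.pow_le_pow_right ?_ (pow_mem_matrix_pow hX (i + 1 + 1) a a)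
    nlinarith

end LogTraceCongr

/-! ### Homogeneous tensors and cyclic coinvariants. -/

section TensorLemmas

variable {H : Type*} [AddCommGroup H] [Module ℚ H]

theorem degPart_toTensorAlgebra (n : ℕ) (w : ⨂[ℚ]^n H) :
    degPart H n (TensorPower.toTensorAlgebra w) = w := by
  rw [degPart, LinearMap.comp_apply]
  have h : (TensorAlgebra.equivDirectSum (R := ℚ) (M := H)).toLinearMap
      (TensorPower.toTensorAlgebra w) = DirectSum.of (fun n => ⨂[ℚ]^n H) n w := by
    change TensorAlgebra.equivDirectSum _ = _
    rw [← AlgEquiv.eq_symm_apply]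
    induction w using PiTensorProduct.induction_on with
    | smul_tprod r v =>
      rw [← DirectSum.lof_eq_of ℚ, map_smul, map_smul, map_smul, DirectSum.lof_eq_of]
      exact congrArg (r • ·) ((TensorPower.toTensorAlgebra_tprod v).trans
        (TensorAlgebra.ofDirectSum_of_tprod v).symm)
    | add x y hx hy => rw [map_add, map_add, map_add, hx, hy]
  rw [h, ← DirectSum.lof_eq_of ℚ, DirectSum.component.lof_self]

theorem ι_mul_tprod {m : ℕ} (x : H) (v : Fin m → H) :
    TensorAlgebra.ι ℚ x * TensorAlgebra.tprod ℚ H m v =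
      TensorAlgebra.tprod ℚ H (m + 1) (Fin.cons x v) := by
  simp [TensorAlgebra.tprod_apply, List.ofFn_succ]

theorem tprod_mul_ι {m : ℕ} (x : H) (v : Fin m → H) :
    TensorAlgebra.tprod ℚ H m v * TensorAlgebra.ι ℚ x =
      TensorAlgebra.tprod ℚ H (m + 1) (Fin.snoc v x) := by
  simp only [TensorAlgebra.tprod_apply, List.ofFn_succ', List.concat_eq_append,
    List.prod_append, Fin.snoc_castSucc, Fin.snoc_last, List.prod_singleton]

theorem tprod_mem_range_ι_pow {m : ℕ} (v : Fin m → H) :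
    TensorAlgebra.tprod ℚ H m v ∈ LinearMap.range (TensorAlgebra.ι ℚ (M := H)) ^ m := by
  induction m with
  | zero => simp [TensorAlgebra.tprod_apply]
  | succ m ih =>
    rw [← Fin.cons_self_tail v, ← ι_mul_tprod, pow_succ']
    exact Submodule.mul_mem_mul ⟨_, rfl⟩ (ih _)

/-- This links the two models of degree `n` tensors: tensor powers, on which permutations act, and
powers of the range of `ι`, which suit inductions on products. -/
theorem range_toTensorAlgebra (n : ℕ) :
    LinearMap.range (TensorPower.toTensorAlgebra : ⨂[ℚ]^n H →ₗ[ℚ] TensorAlgebra ℚ H) =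
      LinearMap.range (TensorAlgebra.ι ℚ (M := H)) ^ n := by
  apply le_antisymm
  · rintro _ ⟨w, rfl⟩
    induction w using PiTensorProduct.induction_on with
    | smul_tprod r v =>
      rw [map_smul, TensorPower.toTensorAlgebra_tprod]
      exact Submodule.smul_mem _ _ (tprod_mem_range_ι_pow v)
    | add x y hx hy => rw [map_add]; exact add_mem hx hy
  · induction n with
    | zero =>
      rw [pow_zero]
      rintro _ ⟨r, rfl⟩
      refine ⟨r • PiTensorProduct.tprod ℚ Fin.elim0, ?_⟩
      rw [map_smul, TensorPower.toTensorAlgebra_tprod]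
      simp [TensorAlgebra.tprod_apply]
    | succ n ih =>
      rw [pow_succ']
      refine Submodule.mul_le.mpr ?_
      rintro _ ⟨x, rfl⟩ b hb
      obtain ⟨w, rfl⟩ := ih hb
      clear hb
      induction w using PiTensorProduct.induction_on with
      | smul_tprod r v =>
        refine ⟨r • PiTensorProduct.tprod ℚ (Fin.cons x v), ?_⟩
        rw [map_smul, map_smul, TensorPower.toTensorAlgebra_tprod,
          TensorPower.toTensorAlgebra_tprod, mul_smul_comm, ι_mul_tprod]
      | add x y hx hy =>
        rw [map_add, mul_add]
        exact add_mem hx hy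

/-- A homogeneous tensor of degree `k + 1` that is trivial in the cyclic coinvariants is a sum of
commutators of a vector and a tensor of degree `k`. -/
theorem mem_span_commutators_of_cycPart_eq_zero {k : ℕ} {t : TensorAlgebra ℚ H}
    (ht : t ∈ LinearMap.range (TensorAlgebra.ι ℚ (M := H)) ^ (k + 1))
    (h0 : cycPart H (k + 1) t = 0) :
    t ∈ Submodule.span ℚ {z | ∃ (x : H) (b : TensorAlgebra ℚ H),
      b ∈ LinearMap.range (TensorAlgebra.ι ℚ (M := H)) ^ k ∧
        z = TensorAlgebra.ι ℚ x * b - b * TensorAlgebra.ι ℚ x} := by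
  set W := Submodule.span ℚ {z | ∃ (x : H) (b : TensorAlgebra ℚ H),
    b ∈ LinearMap.range (TensorAlgebra.ι ℚ (M := H)) ^ k ∧
      z = TensorAlgebra.ι ℚ x * b - b * TensorAlgebra.ι ℚ x} with hW
  rw [← range_toTensorAlgebra] at ht
  obtain ⟨w, rfl⟩ := ht
  rw [cycPart, LinearMap.comp_apply, degPart_toTensorAlgebra, Submodule.mkQ_apply,
    Submodule.Quotient.mk_eq_zero] at h0
  -- One rotation moves the last vector `x` of `v ⊗ x` to the front, so the difference is the
  -- commutator of `x` and `v`.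
  have hrot : ∀ s : ⨂[ℚ]^(k + 1) H, TensorPower.toTensorAlgebra
      (PiTensorProduct.reindex ℚ (fun _ => H) (finRotate (k + 1)) s) -
        TensorPower.toTensorAlgebra s ∈ W := by
    intro s
    induction s using PiTensorProduct.induction_on with
    | smul_tprod r v =>
      obtain ⟨v, x, rfl⟩ : ∃ (v' : Fin k → H) (x : H), v = Fin.snoc v' x :=
        ⟨Fin.init v, v (Fin.last k), (Fin.snoc_init_self v).symm⟩
      rw [map_smul, map_smul, map_smul, ← smul_sub]
      refine W.smul_mem _ (Submodule.subset_span ⟨x, TensorAlgebra.tprod ℚ H k v,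
        tprod_mem_range_ι_pow v, ?_⟩)
      rw [PiTensorProduct.reindex_tprod, TensorPower.toTensorAlgebra_tprod,
        TensorPower.toTensorAlgebra_tprod, ι_mul_tprod, tprod_mul_ι, Fin.snoc_eq_cons_rotate]
      simp
    | add x y hx hy =>
      simp only [map_add]
      rw [add_sub_add_comm]
      exact add_mem hx hy
  -- `cycSpan` contains all powers of the rotation; their differences telescope into single
  -- rotations.
  have hpow : ∀ (j : ℕ) (s : ⨂[ℚ]^(k + 1) H), TensorPower.toTensorAlgebra
      (PiTensorProduct.reindex ℚ (fun _ => H) (finRotate (k + 1) ^ j) s) -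
        TensorPower.toTensorAlgebra s ∈ W := by
    intro j
    induction j with
    | zero =>
      intro s
      have h1 : PiTensorProduct.reindex ℚ (fun _ => H) (finRotate (k + 1) ^ 0) s = s := by
        rw [pow_zero]
        change PiTensorProduct.reindex ℚ (fun _ => H) (Equiv.refl _) s = s
        rw [PiTensorProduct.reindex_refl]
        rfl
      rw [h1, sub_self]
      exact zero_mem _
    | succ j ih =>
      intro s
      have h1 : PiTensorProduct.reindex ℚ (fun _ => H) (finRotate (k + 1) ^ (j + 1)) s =
          PiTensorProduct.reindex ℚ (fun _ => H) (finRotate (k + 1))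
            (PiTensorProduct.reindex ℚ (fun _ => H) (finRotate (k + 1) ^ j) s) := by
        rw [pow_succ']
        exact (PiTensorProduct.reindex_reindex (R := ℚ) (s := fun _ => H) (finRotate (k + 1) ^ j)
          (finRotate (k + 1)) s).symm
      rw [h1, ← sub_add_sub_cancel]
      exact add_mem (hrot _) (ih s)
  have hle : cycSpan H (k + 1) ≤ W.comap TensorPower.toTensorAlgebra := by
    refine Submodule.span_le.mpr ?_
    rintro _ ⟨j, s, rfl⟩
    change TensorPower.toTensorAlgebra _ ∈ W
    rw [map_sub]
    exact hpow j s
  exact hle h0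

end TensorLemmas

/-! ### Powers of augmentation ideals under ring homomorphisms. -/

section AugmentationPowers

variable {S : Type*} [Ring S] [Algebra ℚ S] {Q : Type*} [Ring Q] [Algebra ℚ Q]
  {ε : S →ₐ[ℚ] ℚ} {ε' : Q →ₐ[ℚ] ℚ} (f : S →+* Q)

/-- The powers of the augmentation ideal. -/
def augPow (ε : S →ₐ[ℚ] ℚ) (k : ℕ) : Ideal S := augIdeal ε ^ k

theorem mem_augPow_zero (x : S) : x ∈ augPow ε 0 := by
  rw [augPow, Submodule.pow_zero, Ideal.one_eq_top]
  trivial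

theorem mem_augPow_one {x : S} : x ∈ augPow ε 1 ↔ ε x = 0 := by
  rw [augPow, Submodule.pow_one]
  rfl

theorem mul_mem_augPow {i j : ℕ} {x y : S} (hx : x ∈ augPow ε i) (hy : y ∈ augPow ε j) :
    x * y ∈ augPow ε (i + j) := by
  rw [augPow, Ideal.IsTwoSided.pow_add]
  exact Ideal.mul_mem_mul hx hy

theorem augPow_succ_induction {k : ℕ} {p : S → Prop} {x : S} (hx : x ∈ augPow ε (k + 1))
    (mul : ∀ a ∈ augPow ε k, ∀ b ∈ augPow ε 1, p (a * b)) (add : ∀ a b, p a → p b → p (a + b)) :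
    p x := by
  rw [augPow, Submodule.pow_succ] at hx
  exact Submodule.mul_induction_on hx (fun a ha b hb => mul a ha b (mem_augPow_one.mpr hb)) add

theorem map_mem_augPow (hf : ∀ x, ε' (f x) = ε x) {k : ℕ} {x : S} (hx : x ∈ augPow ε k) :
    f x ∈ augPow ε' k := by
  unfold augPow at *
  induction k generalizing x with
  | zero => rw [Submodule.pow_zero, Ideal.one_eq_top]; trivial
  | succ k ih =>
    rw [Submodule.pow_succ] at hx
    refine Submodule.mul_induction_on hx ?_ ?_
    · intro a ha b hb
      rw [map_mul, Submodule.pow_succ]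
      exact Ideal.mul_mem_mul (ih ha) ((hf b).trans hb)
    · intro a b ha hb
      rw [map_add]
      exact Ideal.add_mem _ ha hb

theorem exists_of_mem_augPow (hf : ∀ x, ε' (f x) = ε x) (hsurj : Function.Surjective f) {k : ℕ}
    {q : Q} (hq : q ∈ augPow ε' k) : ∃ x ∈ augPow ε k, f x = q := by
  unfold augPow at *
  induction k generalizing q with
  | zero =>
    obtain ⟨x, hx⟩ := hsurj q
    exact ⟨x, by rw [Submodule.pow_zero, Ideal.one_eq_top]; trivial, hx⟩
  | succ k ih =>
    rw [Submodule.pow_succ] at hq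
    refine Submodule.mul_induction_on hq ?_ ?_
    · intro a ha b hb
      obtain ⟨x, hx, rfl⟩ := ih ha
      obtain ⟨y, rfl⟩ := hsurj b
      exact ⟨x * y, by rw [Submodule.pow_succ]; exact Ideal.mul_mem_mul hx ((hf y).symm.trans hb),
        map_mul _ _ _⟩
    · rintro _ _ ⟨x, hx, rfl⟩ ⟨y, hy, rfl⟩
      exact ⟨x + y, Ideal.add_mem _ hx hy, map_add _ _ _⟩

end AugmentationPowers

/-! ### The completion of an algebra with finitely generated augmentation ideal. -/

section CompletionLemmas

variable {R : Type*} [Ring R] [Algebra ℚ R] (ε : R →ₐ[ℚ] ℚ)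

/-- The canonical map `R → R̂`. -/
def toCompletion : R →ₐ[ℚ] completion ε :=
  (AlgHom.pi fun m : ℕ =>
    Ideal.Quotient.mkₐ ℚ (augIdeal ε ^ m)).codRestrict (completion ε) fun _ _ _ _ => rfl

theorem proj_toCompletion (m : ℕ) (r : R) :
    proj ε m (toCompletion ε r) = Ideal.Quotient.mk _ r := rfl

theorem toCompletion_mem_augPow {k : ℕ} {r : R} (hr : r ∈ augPow ε k) :
    toCompletion ε r ∈ augPow (augHat ε) k :=
  map_mem_augPow (toCompletion ε : R →+* completion ε) (fun _ => rfl) hr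

variable {ε} {κ : Type*} [Fintype κ] {e : κ → R}

/-- The gain is that the coefficients lie in `I ^ k`: this makes infinite sums of such coefficients
converge in the completion. -/
theorem exists_coeff_of_mem_pow_succ
    (hgen : ∀ r ∈ augIdeal ε, ∃ s : κ → R, r = ∑ i, s i * e i) {k : ℕ} {r : R}
    (hr : r ∈ augIdeal ε ^ (k + 1)) :
    ∃ s : κ → R, (∀ i, s i ∈ augIdeal ε ^ k) ∧ r = ∑ i, s i * e i := by
  rw [Submodule.pow_succ] at hr
  refine Submodule.mul_induction_on hr ?_ ?_
  · intro a ha b hb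
    obtain ⟨s, rfl⟩ := hgen b hb
    refine ⟨fun i => a * s i, fun i => Ideal.mul_mem_right _ _ ha, ?_⟩
    rw [Finset.mul_sum]
    simp only [mul_assoc]
  · rintro _ _ ⟨s, hs, rfl⟩ ⟨t, ht, rfl⟩
    refine ⟨s + t, fun i => Ideal.add_mem _ (hs i) (ht i), ?_⟩
    simp only [Pi.add_apply, add_mul, Finset.sum_add_distrib]

/-- If the augmentation ideal is finitely generated as a left ideal, the kernel of
`R̂ → R / I ^ 2` is contained in `Î ^ 2`. -/
theorem mem_hatIdeal_sq_of_proj_eq_zero (he : ∀ i, e i ∈ augIdeal ε)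
    (hgen : ∀ r ∈ augIdeal ε, ∃ s : κ → R, r = ∑ i, s i * e i) {x : completion ε}
    (hx : proj ε 2 x = 0) : x ∈ hatIdeal ε ^ 2 := by
  -- Lifts of `x` modulo `I ^ (m + 2)`. The lift for `m = 0` can be taken to be zero by hypothesis,
  -- so that `x` becomes the sum of the successive differences.
  have h1 : ∀ m : ℕ, ∃ r : R, Ideal.Quotient.mk (augIdeal ε ^ (m + 2)) r = proj ε (m + 2) x ∧
      (m = 0 → r = 0) := by
    intro m
    cases m with
    | zero => exact ⟨0, by rw [map_zero]; exact hx.symm, fun _ => rfl⟩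
    | succ m =>
      obtain ⟨r, hr⟩ := Ideal.Quotient.mk_surjective (proj ε (m + 1 + 2) x)
      exact ⟨r, hr, fun h => absurd h (Nat.succ_ne_zero m)⟩
  choose ρ hρ hρ0 using h1
  have hcompat : ∀ k m : ℕ, k ≤ m + 2 → Ideal.Quotient.mk (augIdeal ε ^ k) (ρ m) = proj ε k x := by
    intro k m hkm
    have h := x.2 k (m + 2) hkm
    change Ideal.Quotient.factor _ (proj ε (m + 2) x) = proj ε k x at h
    rw [← h, ← hρ]
    rfl
  have hδ : ∀ m, ρ (m + 1) - ρ m ∈ augIdeal ε ^ (m + 1 + 1) := by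
    intro m
    rw [← Ideal.Quotient.eq, hcompat _ _ (by omega), hcompat _ _ (by omega)]
  choose s hs hsum using fun m => exists_coeff_of_mem_pow_succ hgen (hδ m)
  -- The series `∑_j s_j` converges because `s_j` has entries in `I ^ (j + 1)`; its first `m` terms
  -- already determine it modulo `I ^ m`. Finiteness of `κ` then makes `x = ∑_i y_i e_i` an honest
  -- element of `Î ^ 2`.
  let y : κ → completion ε := fun i =>
    ⟨fun m => Ideal.Quotient.mk _ (∑ j ∈ Finset.range m, s j i), by
      intro k m hkm
      change Ideal.Quotient.mk _ (∑ j ∈ Finset.range m, s j i) = Ideal.Quotient.mk _ _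
      rw [Ideal.Quotient.eq, ← Finset.sum_range_add_sum_Ico _ hkm, add_sub_cancel_left]
      refine Ideal.sum_mem _ fun j hj => ?_
      exact Ideal.pow_le_pow_right (by have := (Finset.mem_Ico.mp hj).1; omega) (hs j i)⟩
  have hy : ∀ i, y i ∈ hatIdeal ε := by
    intro i
    change ε (∑ j ∈ Finset.range 1, s j i) = 0
    rw [Finset.sum_range_one]
    have h := hs 0 i
    rw [zero_add, Submodule.pow_one] at h
    exact h
  have hρsum : ∀ m, ρ m = ∑ j ∈ Finset.range m, ∑ i, s j i * e i := by
    intro m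
    induction m with
    | zero => rw [hρ0 0 rfl, Finset.sum_range_zero]
    | succ m ih => rw [Finset.sum_range_succ, ← ih, ← hsum, add_sub_cancel]
  have hxy : x = ∑ i, y i * toCompletion ε (e i) := by
    apply Subtype.ext
    funext m
    change proj ε m x = proj ε m (∑ i, y i * toCompletion ε (e i))
    rw [map_sum, ← hcompat m m (by omega), hρsum, Finset.sum_comm, map_sum]
    refine Finset.sum_congr rfl fun i _ => ?_
    rw [map_mul, proj_toCompletion, ← Finset.sum_mul, map_mul]
    rfl
  rw [hxy]
  refine Ideal.sum_mem _ fun i _ => ?_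
  rw [Submodule.pow_succ, Submodule.pow_one]
  exact Ideal.mul_mem_mul (hy i) (he i)

theorem exists_sub_toCompletion_mem_sq (he : ∀ i, e i ∈ augIdeal ε)
    (hgen : ∀ r ∈ augIdeal ε, ∃ s : κ → R, r = ∑ i, s i * e i) {x : completion ε}
    (hx : x ∈ augPow (augHat ε) 1) :
    ∃ r ∈ augIdeal ε, x - toCompletion ε r ∈ augPow (augHat ε) 2 := by
  obtain ⟨r, hr, hr'⟩ := proj_mem_of_mem_hatIdeal_pow ε 1 x hx 2
  refine ⟨r, by rwa [Submodule.pow_one] at hr, mem_hatIdeal_sq_of_proj_eq_zero he hgen ?_⟩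
  rw [map_sub, hr', proj_toCompletion, sub_self]

end CompletionLemmas

/-! ### Augmentation powers in the truncated completion. -/

section QuotientLemmas

variable {R : Type*} [Ring R] [Algebra ℚ R] (ε : R →ₐ[ℚ] ℚ)

theorem mk_mem_augPow {n k : ℕ} {x : completion ε} (hx : x ∈ augPow (augHat ε) k) :
    (Ideal.Quotient.mk _ x : HatQuot ε (n + 1)) ∈ augPow (augQuot ε n) k :=
  map_mem_augPow (ε := augHat ε) (Ideal.Quotient.mk (hatIdeal ε ^ (n + 1))) (fun _ => rfl) hx

theorem exists_mk_of_mem_augPow {n k : ℕ} {q : HatQuot ε (n + 1)}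
    (hq : q ∈ augPow (augQuot ε n) k) : ∃ x ∈ augPow (augHat ε) k, Ideal.Quotient.mk _ x = q :=
  exists_of_mem_augPow (ε := augHat ε) (Ideal.Quotient.mk (hatIdeal ε ^ (n + 1))) (fun _ => rfl)
    Ideal.Quotient.mk_surjective hq

theorem augPow_eq_bot (n : ℕ) {m : ℕ} (hm : n + 1 ≤ m) : augPow (augQuot ε n) m = ⊥ := by
  rw [eq_bot_iff]
  intro q hq
  obtain ⟨x, hx, rfl⟩ := exists_mk_of_mem_augPow ε hq
  exact Ideal.Quotient.eq_zero_iff_mem.mpr (Ideal.pow_le_pow_right hm hx)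

/-- The reduction `R̂ / Î ^ (n + 1) → R̂ / Î ^ (k + 1)`. -/
def redTo {n k : ℕ} (h : k ≤ n) : HatQuot ε (n + 1) →ₐ[ℚ] HatQuot ε (k + 1) :=
  Ideal.Quotient.factorₐ ℚ (Ideal.pow_le_pow_right (Nat.succ_le_succ h))

end QuotientLemmas

/-! ### Homogeneous tensors as leading terms. -/

section TensorFiltration

variable {H : Type*} [AddCommGroup H] [Module ℚ H] {S : Type*} [Ring S] [Algebra ℚ S]
  {ε : S →ₐ[ℚ] ℚ} {F : TensorAlgebra ℚ H →ₐ[ℚ] S}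

theorem map_tensor_mem_augPow (hF : ∀ h, F (TensorAlgebra.ι ℚ h) ∈ augPow ε 1) {k : ℕ}
    {t : TensorAlgebra ℚ H} (ht : t ∈ LinearMap.range (TensorAlgebra.ι ℚ (M := H)) ^ k) :
    F t ∈ augPow ε k := by
  induction k generalizing t with
  | zero => exact mem_augPow_zero _
  | succ k ih =>
    rw [pow_succ] at ht
    refine Submodule.mul_induction_on ht ?_ ?_
    · rintro a ha _ ⟨h, rfl⟩
      rw [map_mul]
      exact mul_mem_augPow (ih ha) (hF h)
    · intro a c ha hc
      rw [map_add]
      exact Ideal.add_mem _ ha hc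

/-- If `H` spans the augmentation ideal modulo its square, the tensors of degree `k` span its
power `k` modulo the power `k + 1`. -/
theorem exists_tensor_of_mem_augPow (hF : ∀ h, F (TensorAlgebra.ι ℚ h) ∈ augPow ε 1)
    (hspan : ∀ z ∈ augPow ε 1, ∃ h, z - F (TensorAlgebra.ι ℚ h) ∈ augPow ε 2) {k : ℕ} {x : S}
    (hx : x ∈ augPow ε k) : ∃ t ∈ LinearMap.range (TensorAlgebra.ι ℚ (M := H)) ^ k,
      x - F t ∈ augPow ε (k + 1) := by
  induction k generalizing x with
  | zero =>
    refine ⟨algebraMap ℚ _ (ε x), ?_, ?_⟩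
    · rw [pow_zero]
      exact Submodule.algebraMap_mem _
    · rw [zero_add, mem_augPow_one]
      simp
  | succ k ih =>
    refine augPow_succ_induction (p := fun x => ∃ t ∈
      LinearMap.range (TensorAlgebra.ι ℚ (M := H)) ^ (k + 1), x - F t ∈ augPow ε (k + 1 + 1)) hx
        ?_ ?_
    · intro y hy z hz
      obtain ⟨t, ht, ht'⟩ := ih hy
      obtain ⟨h, hh⟩ := hspan z hz
      refine ⟨t * TensorAlgebra.ι ℚ h, ?_, ?_⟩
      · rw [pow_succ]
        exact Submodule.mul_mem_mul ht ⟨h, rfl⟩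
      · have h5 : y * z - F (t * TensorAlgebra.ι ℚ h) =
            (y - F t) * z + F t * (z - F (TensorAlgebra.ι ℚ h)) := by
          rw [map_mul, sub_mul, mul_sub]
          abel
        rw [h5]
        have h6 := mul_mem_augPow (map_tensor_mem_augPow hF ht) hh
        exact Ideal.add_mem _ (mul_mem_augPow ht' hz) h6
    · rintro y z ⟨t, ht, ht'⟩ ⟨s, hs, hs'⟩
      refine ⟨t + s, add_mem ht hs, ?_⟩
      rw [map_add, add_sub_add_comm]
      exact Ideal.add_mem _ ht' hs'

/-- A homogeneous tensor that is trivial in the cyclic coinvariants is mapped to a sum of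
commutators. -/
theorem map_tensor_mem_span_commutators (hF : ∀ h, F (TensorAlgebra.ι ℚ h) ∈ augPow ε 1) {k : ℕ}
    {t : TensorAlgebra ℚ H} (ht : t ∈ LinearMap.range (TensorAlgebra.ι ℚ (M := H)) ^ (k + 1))
    (h0 : cycPart H (k + 1) t = 0) :
    F t ∈ Submodule.span ℚ {z : S | ∃ y y' : S,
      y * y' ∈ augPow ε (k + 1) ∧ y' * y ∈ augPow ε (k + 1) ∧ z = y * y' - y' * y} := by
  have h1 := Submodule.mem_map_of_mem (f := F.toLinearMap)
    (mem_span_commutators_of_cycPart_eq_zero ht h0)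
  rw [Submodule.map_span] at h1
  refine Submodule.span_mono ?_ h1
  rintro _ ⟨_, ⟨h, c, hc, rfl⟩, rfl⟩
  have hh : TensorAlgebra.ι ℚ h ∈ LinearMap.range (TensorAlgebra.ι ℚ (M := H)) := ⟨h, rfl⟩
  refine ⟨F (TensorAlgebra.ι ℚ h), F c, ?_, ?_, by simp⟩
  · rw [← map_mul]
    refine map_tensor_mem_augPow hF ?_
    rw [pow_succ']
    exact Submodule.mul_mem_mul hh hc
  · rw [← map_mul]
    refine map_tensor_mem_augPow hF ?_
    rw [pow_succ]
    exact Submodule.mul_mem_mul hc hh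

end TensorFiltration

/-! ### Functionals that detect elements modulo commutators. -/

section DetectsCommutators

variable {R : Type*} [Ring R] [Algebra ℚ R] {ε : R →ₐ[ℚ] ℚ} {V : ℕ → Type*}
  [∀ k, AddCommGroup (V k)] [∀ k, Module ℚ (V k)] (φ : ∀ k, HatQuot ε (k + 1) →ₗ[ℚ] V k)

/-- The functionals `φ` detect elements of the powers of `Î` modulo commutators. -/
def DetectsCommutators : Prop :=
  ∀ (k : ℕ) (x : completion ε), x ∈ augPow (augHat ε) (k + 1) →
    φ (k + 1) (Ideal.Quotient.mk _ x) = 0 →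
      ∃ s ∈ Submodule.span ℚ {z : completion ε | ∃ y y' : completion ε,
        y * y' ∈ augPow (augHat ε) (k + 1) ∧ y' * y ∈ augPow (augHat ε) (k + 1) ∧
          z = y * y' - y' * y}, x - s ∈ augPow (augHat ε) (k + 2)

end DetectsCommutators

/-! ### Leading tensors in the completion. -/

section TensorLift

variable {R : Type*} [Ring R] [Algebra ℚ R] {ε : R →ₐ[ℚ] ℚ} {H : Type*} [AddCommGroup H]
  [Module ℚ H] {E : TensorAlgebra ℚ H →ₐ[ℚ] R} {κ : Type*} [Fintype κ] {e : κ → R}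

theorem toCompletion_comp_ι_mem (hE : ∀ h, E (TensorAlgebra.ι ℚ h) ∈ augIdeal ε) (h : H) :
    (toCompletion ε).comp E (TensorAlgebra.ι ℚ h) ∈ augPow (augHat ε) 1 :=
  toCompletion_mem_augPow ε (mem_augPow_one.mpr (hE h))

theorem exists_sub_toCompletion_comp_mem
    (hspan : ∀ r ∈ augIdeal ε, ∃ h, r - E (TensorAlgebra.ι ℚ h) ∈ augIdeal ε ^ 2)
    (he : ∀ i, e i ∈ augIdeal ε) (hgen : ∀ r ∈ augIdeal ε, ∃ s : κ → R, r = ∑ i, s i * e i)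
    (z : completion ε) (hz : z ∈ augPow (augHat ε) 1) :
    ∃ h, z - (toCompletion ε).comp E (TensorAlgebra.ι ℚ h) ∈ augPow (augHat ε) 2 := by
  obtain ⟨r, hr, hr'⟩ := exists_sub_toCompletion_mem_sq he hgen hz
  obtain ⟨h, hh⟩ := hspan r hr
  refine ⟨h, ?_⟩
  have h4 := Ideal.add_mem _ hr' (toCompletion_mem_augPow ε hh)
  rw [map_sub, sub_add_sub_cancel] at h4
  exact h4

theorem exists_tensor_sub_toCompletion_mem (hE : ∀ h, E (TensorAlgebra.ι ℚ h) ∈ augIdeal ε)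
    (hspan : ∀ r ∈ augIdeal ε, ∃ h, r - E (TensorAlgebra.ι ℚ h) ∈ augIdeal ε ^ 2)
    (he : ∀ i, e i ∈ augIdeal ε) (hgen : ∀ r ∈ augIdeal ε, ∃ s : κ → R, r = ∑ i, s i * e i)
    {k : ℕ} {x : completion ε} (hx : x ∈ augPow (augHat ε) k) :
    ∃ t ∈ LinearMap.range (TensorAlgebra.ι ℚ (M := H)) ^ k,
      x - (toCompletion ε).comp E t ∈ augPow (augHat ε) (k + 1) := by
  have h1 := toCompletion_comp_ι_mem hE
  have h2 := exists_sub_toCompletion_comp_mem hspan he hgen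
  generalize (toCompletion ε).comp E = F at *
  exact exists_tensor_of_mem_augPow h1 h2 hx

/-- `φ` maps the image of a homogeneous tensor to its class in the cyclic coinvariants. -/
def ExtendsCycPart (E : TensorAlgebra ℚ H →ₐ[ℚ] R)
    (φ : ∀ k, HatQuot ε (k + 1) →ₗ[ℚ] CycTensor H k) : Prop :=
  ∀ (k : ℕ) (t : TensorAlgebra ℚ H), t ∈ LinearMap.range (TensorAlgebra.ι ℚ (M := H)) ^ k →
    φ k (Ideal.Quotient.mk _ (toCompletion ε (E t))) = cycPart H k t

variable {φ ψ : ∀ k, HatQuot ε (k + 1) →ₗ[ℚ] CycTensor H k}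

theorem ExtendsCycPart.apply_of_sub_mem (hφ : ExtendsCycPart E φ) {k : ℕ} {t : TensorAlgebra ℚ H}
    {x : completion ε} (ht : t ∈ LinearMap.range (TensorAlgebra.ι ℚ (M := H)) ^ k)
    (hx : x - (toCompletion ε).comp E t ∈ augPow (augHat ε) (k + 1)) :
    φ k (Ideal.Quotient.mk _ x) = cycPart H k t := by
  have e : (Ideal.Quotient.mk _ x : HatQuot ε (k + 1)) =
      Ideal.Quotient.mk _ (toCompletion ε (E t)) := Ideal.Quotient.eq.mpr hx
  rw [e, hφ k t ht]

/-- Functionals that extend `cycPart` agree on `Î ^ k`. -/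
theorem ExtendsCycPart.eq_on (hφ : ExtendsCycPart E φ) (hψ : ExtendsCycPart E ψ)
    (hE : ∀ h, E (TensorAlgebra.ι ℚ h) ∈ augIdeal ε)
    (hspan : ∀ r ∈ augIdeal ε, ∃ h, r - E (TensorAlgebra.ι ℚ h) ∈ augIdeal ε ^ 2)
    (he : ∀ i, e i ∈ augIdeal ε) (hgen : ∀ r ∈ augIdeal ε, ∃ s : κ → R, r = ∑ i, s i * e i)
    {k : ℕ} {x : completion ε} (hx : x ∈ augPow (augHat ε) k) :
    φ k (Ideal.Quotient.mk _ x) = ψ k (Ideal.Quotient.mk _ x) := by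
  obtain ⟨t, ht, ht'⟩ := exists_tensor_sub_toCompletion_mem hE hspan he hgen hx
  rw [hφ.apply_of_sub_mem ht ht', hψ.apply_of_sub_mem ht ht']

/-- Every cyclic tensor of degree `k` comes from `Î ^ k`. -/
theorem ExtendsCycPart.exists_eq (hφ : ExtendsCycPart E φ)
    (hE : ∀ h, E (TensorAlgebra.ι ℚ h) ∈ augIdeal ε) {k : ℕ} (c : CycTensor H k) :
    ∃ x ∈ augPow (augHat ε) k, φ k (Ideal.Quotient.mk _ x) = c := by
  obtain ⟨w, rfl⟩ := (cycSpan H k).mkQ_surjective c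
  have ht : TensorPower.toTensorAlgebra w ∈ LinearMap.range (TensorAlgebra.ι ℚ (M := H)) ^ k := by
    rw [← range_toTensorAlgebra]
    exact ⟨w, rfl⟩
  refine ⟨_, map_tensor_mem_augPow (toCompletion_comp_ι_mem hE) ht, ?_⟩
  rw [AlgHom.comp_apply, hφ k _ ht, cycPart, LinearMap.comp_apply, degPart_toTensorAlgebra]

/-- The functional sees only the cyclic class of the leading tensor of `x`. If that class is zero,
the tensor is a sum of commutators, and its image serves as `s`. -/
theorem ExtendsCycPart.detectsCommutators (hφ : ExtendsCycPart E φ)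
    (hE : ∀ h, E (TensorAlgebra.ι ℚ h) ∈ augIdeal ε)
    (hspan : ∀ r ∈ augIdeal ε, ∃ h, r - E (TensorAlgebra.ι ℚ h) ∈ augIdeal ε ^ 2)
    (he : ∀ i, e i ∈ augIdeal ε) (hgen : ∀ r ∈ augIdeal ε, ∃ s : κ → R, r = ∑ i, s i * e i) :
    DetectsCommutators φ := by
  intro k x hx h0
  obtain ⟨t, ht, ht'⟩ := exists_tensor_sub_toCompletion_mem hE hspan he hgen hx
  rw [hφ.apply_of_sub_mem ht ht'] at h0
  exact ⟨(toCompletion ε).comp E t, map_tensor_mem_span_commutators (toCompletion_comp_ι_mem hE)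
    ht h0, ht'⟩

end TensorLift

/-! ### The group algebra of a free group and leading terms of Magnus expansions. -/

section GroupAlgebra

variable {π : Type*} [Group π]

/-- The element `γ - 1` of the group algebra. -/
def subOne (γ : π) : MonoidAlgebra ℚ π := MonoidAlgebra.of ℚ π γ - 1

theorem groupAug_of (γ : π) : groupAug π (MonoidAlgebra.of ℚ π γ) = 1 := by
  simp [groupAug]

theorem subOne_mem (γ : π) : subOne γ ∈ augIdeal (groupAug π) := by
  change groupAug π (subOne γ) = 0
  rw [subOne, map_sub, groupAug_of, map_one, sub_self]

theorem subOne_mul (γ δ : π) : subOne (γ * δ) = subOne γ * subOne δ + subOne γ + subOne δ := by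
  simp only [subOne, map_mul]
  noncomm_ring

/-- Every element of `ℚπ` differs from its augmentation by a linear combination of elements
`γ - 1`. -/
theorem sub_groupAug_mem_span (r : MonoidAlgebra ℚ π) :
    r - algebraMap ℚ _ (groupAug π r) ∈ Submodule.span ℚ (Set.range (subOne (π := π))) := by
  induction r using MonoidAlgebra.induction_on with
  | of γ =>
    rw [groupAug_of, map_one]
    exact Submodule.subset_span ⟨γ, rfl⟩
  | add x y hx hy =>
    rw [map_add, map_add, add_sub_add_comm]
    exact add_mem hx hy
  | smul c x hx =>
    rw [map_smul, smul_eq_mul, map_mul, ← Algebra.smul_def, ← smul_sub]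
    exact Submodule.smul_mem _ _ hx

theorem mem_span_of_mem_augIdeal {r : MonoidAlgebra ℚ π} (hr : r ∈ augIdeal (groupAug π)) :
    r ∈ Submodule.span ℚ (Set.range (subOne (π := π))) := by
  have h := sub_groupAug_mem_span r
  rwa [show groupAug π r = 0 from hr, map_zero, sub_zero] at h

/-- The augmentation ideal of a free group is generated by the elements `x - 1` for the elements `x`
of a basis. -/
theorem exists_coeff_of_mem_augIdeal {κ : Type*} [Fintype κ] (b : FreeGroupBasis κ π)
    {r : MonoidAlgebra ℚ π} (hr : r ∈ augIdeal (groupAug π)) :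
    ∃ s : κ → MonoidAlgebra ℚ π, r = ∑ i, s i * subOne (b i) := by
  let L : Ideal (MonoidAlgebra ℚ π) := Ideal.span (Set.range fun i => subOne (b i))
  -- The `γ` with `γ - 1` in the left ideal `L` form a subgroup; it contains the basis and so is
  -- everything.
  have hinv : ∀ γ : π, subOne γ ∈ L → subOne γ⁻¹ ∈ L := by
    intro γ hγ
    have h : subOne γ⁻¹ = -(MonoidAlgebra.of ℚ π γ⁻¹ * subOne γ) := by
      rw [subOne, subOne, mul_sub, ← map_mul, inv_mul_cancel, map_one, mul_one, neg_sub]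
    rw [h]
    exact neg_mem (L.mul_mem_left _ hγ)
  have hmul : ∀ γ δ : π, subOne γ ∈ L → subOne δ ∈ L → subOne (γ * δ) ∈ L := by
    intro γ δ hγ hδ
    rw [subOne_mul]
    exact add_mem (add_mem (L.mul_mem_left _ hδ) hγ) hδ
  have hfree : ∀ w : FreeGroup κ, subOne (b.repr.symm w) ∈ L := by
    intro w
    induction w using FreeGroup.induction_on with
    | C1 =>
      rw [map_one, subOne, map_one, sub_self]
      exact zero_mem _
    | of i => exact Ideal.subset_span ⟨i, rfl⟩
    | inv_of i hi =>
      rw [map_inv]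
      exact hinv _ hi
    | mul x y hx hy =>
      rw [map_mul]
      exact hmul _ _ hx hy
  have hle : Submodule.span ℚ (Set.range (subOne (π := π))) ≤ L.restrictScalars ℚ := by
    refine Submodule.span_le.mpr ?_
    rintro _ ⟨γ, rfl⟩
    have h := hfree (b.repr γ)
    rwa [MulEquiv.symm_apply_apply] at h
  obtain ⟨s, hs⟩ := (Submodule.mem_span_range_iff_exists_fun _).mp
    (show r ∈ L from hle (mem_span_of_mem_augIdeal hr))
  exact ⟨s, hs.symm⟩

/-- The linear map `H → ℚπ / I ^ 2`, `[γ] ↦ γ - 1`. -/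
def classMap (π : Type*) [Group π] :
    RatH1 π →ₗ[ℚ] MonoidAlgebra ℚ π ⧸ augIdeal (groupAug π) ^ 2 :=
  LinearMap.liftBaseChange ℚ (AddMonoidHom.toIntLinearMap (MonoidHom.toAdditiveLeft
    (Abelianization.lift (MonoidHom.mk' (fun γ : π =>
      Multiplicative.ofAdd (Ideal.Quotient.mk (augIdeal (groupAug π) ^ 2) (subOne γ)))
      fun γ δ => by
        rw [← ofAdd_add, ← map_add]
        congr 1
        rw [Ideal.Quotient.eq, subOne_mul, add_assoc, add_sub_cancel_right, Submodule.pow_succ,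
          Submodule.pow_one]
        exact Ideal.mul_mem_mul (subOne_mem γ) (subOne_mem δ)))))

theorem classMap_homClass (γ : π) :
    classMap π (homClass γ) = Ideal.Quotient.mk _ (subOne γ) := by
  rw [classMap, homClass, LinearMap.liftBaseChange_tmul, one_smul]
  rfl

theorem span_homClass : Submodule.span ℚ (Set.range (homClass (π := π))) = ⊤ := by
  rw [eq_top_iff]
  rintro h -
  induction h using TensorProduct.induction_on with
  | zero => exact zero_mem _
  | tmul q a =>
    obtain ⟨γ, hγ⟩ := QuotientGroup.mk_surjective a.toMul
    have e : q ⊗ₜ[ℤ] a = q • homClass γ := by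
      rw [homClass, TensorProduct.smul_tmul', smul_eq_mul, mul_one]
      congr 1
      exact (congrArg Additive.ofMul hγ).symm
    rw [e]
    exact Submodule.smul_mem _ _ (Submodule.subset_span ⟨γ, rfl⟩)
  | add x y hx hy => exact add_mem hx hy

/-- `H` is a vector space over `ℚ`, hence projective, so `classMap` lifts through the quotient map
without any basis of `π`. -/
theorem exists_linearLift (π : Type*) [Group π] : ∃ e : RatH1 π →ₗ[ℚ] MonoidAlgebra ℚ π,
    ∀ γ : π, e (homClass γ) - subOne γ ∈ augIdeal (groupAug π) ^ 2 := by
  obtain ⟨e, he⟩ := Module.projective_lifting_property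
    (Ideal.Quotient.mkₐ ℚ (augIdeal (groupAug π) ^ 2)).toLinearMap (classMap π)
    Ideal.Quotient.mk_surjective
  refine ⟨e, fun γ => ?_⟩
  rw [← Ideal.Quotient.eq, ← classMap_homClass, ← he]
  rfl

/-- A linear map `H → ℚπ` with `[γ] ↦ γ - 1` modulo `I ^ 2`. -/
def linearLift (π : Type*) [Group π] : RatH1 π →ₗ[ℚ] MonoidAlgebra ℚ π :=
  (exists_linearLift π).choose

theorem linearLift_homClass_sub_mem (γ : π) :
    linearLift π (homClass γ) - subOne γ ∈ augIdeal (groupAug π) ^ 2 :=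
  (exists_linearLift π).choose_spec γ

theorem linearLift_mem (h : RatH1 π) : linearLift π h ∈ augIdeal (groupAug π) := by
  have hle : Submodule.span ℚ (Set.range (homClass (π := π))) ≤
      ((augIdeal (groupAug π)).restrictScalars ℚ).comap (linearLift π) := by
    refine Submodule.span_le.mpr ?_
    rintro _ ⟨γ, rfl⟩
    have h := Ideal.add_mem _ (Ideal.pow_le_self two_ne_zero (linearLift_homClass_sub_mem γ))
      (subOne_mem γ)
    rwa [sub_add_cancel] at h
  rw [span_homClass] at hle
  exact hle (Submodule.mem_top (x := h))

theorem exists_sub_linearLift_mem {r : MonoidAlgebra ℚ π} (hr : r ∈ augIdeal (groupAug π)) :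
    ∃ h : RatH1 π, r - linearLift π h ∈ augIdeal (groupAug π) ^ 2 := by
  have h := mem_span_of_mem_augIdeal hr
  induction h using Submodule.span_induction with
  | mem x hx =>
    obtain ⟨γ, rfl⟩ := hx
    exact ⟨homClass γ, by rw [← neg_sub]; exact neg_mem (linearLift_homClass_sub_mem γ)⟩
  | zero => exact ⟨0, by rw [map_zero, sub_zero]; exact zero_mem _⟩
  | add x y hx hy ihx ihy =>
    have hmem : ∀ z ∈ Submodule.span ℚ (Set.range (subOne (π := π))),
        z ∈ augIdeal (groupAug π) := by
      intro z hz
      have hle : Submodule.span ℚ (Set.range (subOne (π := π))) ≤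
          (augIdeal (groupAug π)).restrictScalars ℚ := by
        refine Submodule.span_le.mpr ?_
        rintro _ ⟨γ, rfl⟩
        exact subOne_mem γ
      exact hle hz
    obtain ⟨a, ha⟩ := ihx (hmem x hx)
    obtain ⟨b, hb⟩ := ihy (hmem y hy)
    exact ⟨a + b, by rw [map_add, add_sub_add_comm]; exact add_mem ha hb⟩
  | smul c x hx ih =>
    have hle : Submodule.span ℚ (Set.range (subOne (π := π))) ≤
        (augIdeal (groupAug π)).restrictScalars ℚ := by
      refine Submodule.span_le.mpr ?_
      rintro _ ⟨γ, rfl⟩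
      exact subOne_mem γ
    obtain ⟨a, ha⟩ := ih (hle hx)
    refine ⟨c • a, ?_⟩
    rw [map_smul, ← smul_sub, Algebra.smul_def]
    exact Ideal.mul_mem_left _ _ ha

/-- The algebra homomorphism `T(H) → ℚπ` that extends `linearLift`. -/
def tensorLift (π : Type*) [Group π] : TensorAlgebra ℚ (RatH1 π) →ₐ[ℚ] MonoidAlgebra ℚ π :=
  TensorAlgebra.lift ℚ (linearLift π)

theorem tensorLift_ι (h : RatH1 π) : tensorLift π (TensorAlgebra.ι ℚ h) = linearLift π h :=
  TensorAlgebra.lift_ι_apply _ _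

theorem tensorLift_mem {k : ℕ} {t : TensorAlgebra ℚ (RatH1 π)}
    (ht : t ∈ LinearMap.range (TensorAlgebra.ι ℚ (M := RatH1 π)) ^ k) :
    tensorLift π t ∈ augPow (groupAug π) k :=
  map_tensor_mem_augPow (fun h => by
    rw [tensorLift_ι, mem_augPow_one]
    exact linearLift_mem h) ht

/-- The degree one part of a Magnus expansion on the augmentation ideal. -/
theorem MagnusExpansion.tensorCoeff_one_linearLift (θ : MagnusExpansion π) (h : RatH1 π) :
    tensorCoeff (RatH1 π) 1 (θ.algHom (linearLift π h)) = TensorAlgebra.ι ℚ h := by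
  have hle : Submodule.span ℚ (Set.range (homClass (π := π))) ≤
      LinearMap.eqLocus (tensorCoeff (RatH1 π) 1 ∘ₗ θ.algHom.toLinearMap ∘ₗ linearLift π)
        (TensorAlgebra.ι ℚ) := by
    refine Submodule.span_le.mpr ?_
    rintro _ ⟨γ, rfl⟩
    change tensorCoeff (RatH1 π) 1 (θ.algHom (linearLift π (homClass γ))) = _
    have h1 := θ.tensorCoeff_algHom_eq_zero 2 _ (linearLift_homClass_sub_mem γ) 1 one_lt_two
    rw [map_sub, map_sub, sub_eq_zero] at h1
    rw [h1, subOne, map_sub, map_sub, map_one]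
    have h2 : θ.algHom (MonoidAlgebra.of ℚ π γ) = θ.toHom γ := by
      simp [MagnusExpansion.algHom]
    have h3 : tensorCoeff (RatH1 π) 1 1 = 0 := by
      change PowerSeries.coeff 1 ((1 : completedTensor (RatH1 π)) :
        PowerSeries (TensorAlgebra ℚ (RatH1 π))) = 0
      rw [OneMemClass.coe_one, PowerSeries.coeff_one, if_neg one_ne_zero]
    rw [h2, h3, sub_zero, θ.coeff_one]
  rw [span_homClass] at hle
  exact hle (Submodule.mem_top (x := h))

/-- The leading term of `θ (tensorLift t)` for a homogeneous tensor `t` is `t`. -/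
theorem MagnusExpansion.tensorCoeff_tensorLift (θ : MagnusExpansion π) {k : ℕ}
    {t : TensorAlgebra ℚ (RatH1 π)}
    (ht : t ∈ LinearMap.range (TensorAlgebra.ι ℚ (M := RatH1 π)) ^ k) :
    tensorCoeff (RatH1 π) k (θ.algHom (tensorLift π t)) = t := by
  induction k generalizing t with
  | zero =>
    rw [pow_zero] at ht
    obtain ⟨r, rfl⟩ := Submodule.mem_one.mp ht
    rw [θ.tensorCoeff_zero_algHom]
    rw [AlgHom.commutes, AlgHom.commutes, Algebra.algebraMap_self, RingHom.id_apply]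
  | succ k ih =>
    rw [pow_succ] at ht
    refine Submodule.mul_induction_on ht ?_ ?_
    · rintro a ha _ ⟨h, rfl⟩
      have h1 := θ.tensorCoeff_one_linearLift h
      have h2 := ih ha
      have h0 : tensorCoeff (RatH1 π) 0 (θ.algHom (linearLift π h)) = 0 :=
        θ.tensorCoeff_algHom_eq_zero 1 _ (by rw [Submodule.pow_one]; exact linearLift_mem h) 0
          one_pos
      have h3 := θ.tensorCoeff_algHom_eq_zero k _ (tensorLift_mem ha)
      rw [map_mul, tensorLift_ι, map_mul]
      change PowerSeries.coeff (k + 1) ((θ.algHom (tensorLift π a) * θ.algHom (linearLift π h) :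
        completedTensor (RatH1 π)) : PowerSeries (TensorAlgebra ℚ (RatH1 π))) = _
      -- The left factor has no component below degree `k` and the right one none in degree `0`, so
      -- only the bidegree `(k, 1)` contributes.
      rw [Subalgebra.coe_mul, PowerSeries.coeff_mul, Finset.sum_eq_single (k, 1)]
      · exact congrArg₂ (· * ·) h2 h1
      · rintro ⟨p, q⟩ hp hpq
        rw [Finset.HasAntidiagonal.mem_antidiagonal] at hp
        dsimp only at hp ⊢
        rcases Nat.lt_or_ge p k with hlt | hge
        · rw [show PowerSeries.coeff p (θ.algHom (tensorLift π a) :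
            PowerSeries (TensorAlgebra ℚ (RatH1 π))) = 0 from h3 p hlt, zero_mul]
        · have hq : q = 0 := by
            by_contra hq
            exact hpq (Prod.ext (by dsimp only; omega) (by dsimp only; omega))
          rw [hq, show PowerSeries.coeff 0 (θ.algHom (linearLift π h) :
            PowerSeries (TensorAlgebra ℚ (RatH1 π))) = 0 from h0, mul_zero]
      · intro hk
        exact absurd (Finset.HasAntidiagonal.mem_antidiagonal.mpr (rfl : k + 1 = k + 1)) hk
    · intro a c ha hc
      rw [map_add, map_add, map_add, ha, hc]

end GroupAlgebra

/-! ### Existence of Magnus expansions. -/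

section MagnusExistence

variable {π : Type*} [Group π] {H : Type*} [AddCommGroup H] [Module ℚ H]

open PowerSeries in
/-- The unit `1 + h` of the completed tensor algebra, for `h ∈ H`. -/
def oneAddUnit (h : H) : (completedTensor H)ˣ where
  val := ⟨1 + X * C (TensorAlgebra.ι ℚ h), by
    intro k
    rw [map_add]
    refine add_mem ((completedTensor H).one_mem k) ?_
    cases k with
    | zero => rw [coeff_zero_X_mul]; exact zero_mem _
    | succ k =>
      rw [coeff_succ_X_mul, coeff_C]
      split_ifs with hk
      · rw [hk, zero_add, pow_one]
        exact ⟨h, rfl⟩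
      · exact zero_mem _⟩
  inv := ⟨PowerSeries.mk fun k => (-TensorAlgebra.ι ℚ h) ^ k, by
    intro k
    rw [coeff_mk]
    exact Submodule.pow_mem_pow _ (neg_mem (LinearMap.mem_range_self _ h)) k⟩
  val_inv := by
    apply Subtype.ext
    change (1 + X * C (TensorAlgebra.ι ℚ h)) *
      (PowerSeries.mk fun k => (-TensorAlgebra.ι ℚ h) ^ k) = 1
    ext k
    rw [add_mul, one_mul, mul_assoc, map_add]
    cases k with
    | zero => simp
    | succ k =>
      rw [coeff_succ_X_mul, coeff_C_mul, coeff_mk, coeff_mk, coeff_one, if_neg (Nat.succ_ne_zero k),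
        pow_succ', neg_mul, neg_add_cancel]
  inv_val := by
    apply Subtype.ext
    change (PowerSeries.mk fun k => (-TensorAlgebra.ι ℚ h) ^ k) *
      (1 + X * C (TensorAlgebra.ι ℚ h)) = 1
    ext k
    rw [mul_add, mul_one, ← (commute_X (C (TensorAlgebra.ι ℚ h))).eq, ← mul_assoc, map_add]
    cases k with
    | zero => simp
    | succ k =>
      rw [coeff_succ_mul_X, coeff_mul_C, coeff_mk, coeff_mk, coeff_one, if_neg (Nat.succ_ne_zero k),
        pow_succ, mul_neg, neg_add_cancel]

theorem tensorCoeff_zero_oneAddUnit (h : H) : tensorCoeff H 0 (oneAddUnit h) = 1 := by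
  change PowerSeries.coeff 0 (1 + PowerSeries.X * PowerSeries.C (TensorAlgebra.ι ℚ h)) = 1
  simp

theorem tensorCoeff_one_oneAddUnit (h : H) :
    tensorCoeff H 1 (oneAddUnit h) = TensorAlgebra.ι ℚ h := by
  change PowerSeries.coeff 1 (1 + PowerSeries.X * PowerSeries.C (TensorAlgebra.ι ℚ h)) = _
  rw [map_add, PowerSeries.coeff_one, if_neg one_ne_zero, zero_add, ← zero_add 1,
    PowerSeries.coeff_succ_X_mul]
  simp

variable (H) in
/-- The constant coefficient as a ring homomorphism. -/
def tensorConst : completedTensor H →* TensorAlgebra ℚ H :=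
  (PowerSeries.constantCoeff : PowerSeries (TensorAlgebra ℚ H) →+* TensorAlgebra ℚ H).toMonoidHom.comp
    (completedTensor H).val.toRingHom.toMonoidHom

theorem tensorConst_apply (f : completedTensor H) : tensorConst H f = tensorCoeff H 0 f := by
  change PowerSeries.constantCoeff _ = PowerSeries.coeff 0 _
  rw [PowerSeries.coeff_zero_eq_constantCoeff]

theorem tensorCoeff_one_mul (f f' : completedTensor H) :
    tensorCoeff H 1 (f * f') =
      tensorCoeff H 0 f * tensorCoeff H 1 f' + tensorCoeff H 1 f * tensorCoeff H 0 f' := by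
  change PowerSeries.coeff 1 ((f * f' : completedTensor H) : PowerSeries (TensorAlgebra ℚ H)) = _
  rw [Subalgebra.coe_mul, PowerSeries.coeff_mul, Finset.Nat.antidiagonal_succ]
  simp
  rw [← PowerSeries.coeff_zero_eq_constantCoeff_apply,
    ← PowerSeries.coeff_zero_eq_constantCoeff_apply]
  rfl

/-- Free groups have Magnus expansions. -/
theorem exists_magnusExpansion {κ : Type*} (b : FreeGroupBasis κ π) :
    Nonempty (MagnusExpansion π) := by
  -- Freeness extends `x ↦ 1 + [x]` from the basis once the target is a group, hence the passage to
  -- units.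
  let f : π →* (completedTensor (RatH1 π))ˣ := b.lift fun i => oneAddUnit (homClass (b i))
  have hfb : ∀ i, f (b i) = oneAddUnit (homClass (b i)) := fun i =>
    congrFun (b.lift.symm_apply_apply _) i
  have h0 : ∀ γ, tensorCoeff (RatH1 π) 0 (f γ) = 1 := by
    have h : (Units.map (tensorConst (RatH1 π))).comp f = 1 := by
      refine b.ext_hom _ _ fun i => Units.ext ?_
      change tensorConst (RatH1 π) (f (b i)) = 1
      rw [tensorConst_apply, hfb, tensorCoeff_zero_oneAddUnit]
    intro γ
    have h' := congrArg Units.val (DFunLike.congr_fun h γ)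
    change tensorConst (RatH1 π) (f γ) = 1 at h'
    rwa [tensorConst_apply] at h'
  -- With constant terms equal to `1`, the degree one coefficient is additive, so it suffices to
  -- compare it with `[γ]` on the basis.
  have h1 : ∀ γ, tensorCoeff (RatH1 π) 1 (f γ) = TensorAlgebra.ι ℚ (homClass γ) := by
    let l : π →* Multiplicative (TensorAlgebra ℚ (RatH1 π)) :=
      MonoidHom.mk' (fun γ => Multiplicative.ofAdd (tensorCoeff (RatH1 π) 1 (f γ))) fun γ δ => by
        rw [map_mul, Units.val_mul, tensorCoeff_one_mul, h0, h0, one_mul, mul_one, add_comm,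
          ofAdd_add]
    let r : π →* Multiplicative (TensorAlgebra ℚ (RatH1 π)) :=
      MonoidHom.mk' (fun γ => Multiplicative.ofAdd (TensorAlgebra.ι ℚ (homClass γ))) fun γ δ => by
        rw [← ofAdd_add, ← map_add, homClass, homClass, homClass, ← TensorProduct.tmul_add, map_mul,
          ofMul_mul]
    have h : l = r := by
      refine b.ext_hom _ _ fun i => ?_
      change Multiplicative.ofAdd (tensorCoeff (RatH1 π) 1 (f (b i))) = Multiplicative.ofAdd _
      rw [hfb, tensorCoeff_one_oneAddUnit]
    exact fun γ => DFunLike.congr_fun h γ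
  exact ⟨⟨(Units.coeHom _).comp f, h0, h1⟩⟩

end MagnusExistence

/-! ### One step of the filtration, and the universal trace functional. -/

section KernelFiltration

variable {Q : Type*} [Ring Q] [Algebra ℚ Q] {V : Type*} [AddCommGroup V] [Module ℚ V]
  {ε : Q →ₐ[ℚ] ℚ} {m : ℕ}

theorem K1.map_map {R S T : Type*} [Ring R] [Ring S] [Ring T] (f : R →+* S) (g : S →+* T)
    (z : K1 R) : K1.map g (K1.map f z) = K1.map (g.comp f) z := by
  obtain ⟨N, A, rfl⟩ := K1.mk_surjective z
  rfl

/-- The subgroup of `K₁(Q)` of the classes of the `N × N` matrices congruent to `1` modulo the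
power `k` of the augmentation ideal, for `k ≥ 1`. -/
def K1.augCongr (hm : augPow ε m = ⊥) (N k : ℕ) : Subgroup (K1 Q) :=
  K1.congr (I := augIdeal ε) hm N (k - 1)

/-- The matrix `ε(A)`, viewed over `Q`, has a trivial class because it comes from the trivial class
in `K₁(ℚ)`. Normalizing therefore changes neither the class nor the size. -/
theorem K1.mem_augCongr_one (hm : augPow ε m = ⊥) {N : ℕ} (A : GL (Fin N) Q)
    (hA : K1.map (ε : Q →+* ℚ) (K1.mk A) = 1) : K1.mk A ∈ K1.augCongr hm N 1 := by
  have h1 : K1.mk (glMap (algebraMap ℚ Q) N (glMap (ε : Q →+* ℚ) N A)) = 1 := by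
    rw [← K1.map_mk, ← K1.map_mk, hA, map_one]
  have h2 : K1.mk A = K1.mk (normalized ε A) := by
    rw [normalized, K1.mk_mul, K1.mk_inv, h1, inv_one, mul_one]
  refine ⟨(normalized ε A : Matrix (Fin N) (Fin N) Q) - 1, ?_, ?_⟩
  · rw [Nat.sub_self, zero_add, Submodule.pow_one]
    exact normalized_sub_one_mem_matrix ε A
  · rw [add_sub_cancel, K1.ofMat_coe, h2]

/-- A single `t`, the trace of a representative, serves all functionals at once. This allows
different Magnus expansions, and the values in `H1Lie`, to be compared. -/
theorem K1.exists_of_mem_augCongr (hm : augPow ε m = ⊥) {N k : ℕ} {z : K1 Q}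
    (hz : z ∈ K1.augCongr hm N (k + 1)) : ∃ t ∈ augPow ε (k + 1), ∀ {V : Type*} [AddCommGroup V]
      [Module ℚ V] (τ : Q →ₗ[ℚ] V) (hτ : ∀ a b, τ (a * b) = τ (b * a)),
        (∀ x ∈ augPow ε (k + 2), τ x = 0) →
          K1.logTrace ε hm τ hτ z = Multiplicative.ofAdd (τ t) := by
  obtain ⟨X, hX, rfl⟩ := hz
  exact ⟨X.trace, Ideal.sum_mem _ fun i _ => hX i i, fun τ hτ hk =>
    K1.logTrace_ofMat ε hm τ hτ hk hX⟩

theorem K1.mem_augCongr_succ (hm : augPow ε m = ⊥) (τ : Q →ₗ[ℚ] V)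
    (hτ : ∀ a b, τ (a * b) = τ (b * a)) {N k : ℕ} (hk : ∀ x ∈ augPow ε (k + 2), τ x = 0)
    (hstep : ∀ x ∈ augPow ε (k + 1), τ x = 0 → ∃ s ∈ Submodule.span ℚ {z : Q | ∃ a b : Q,
      a * b ∈ augPow ε (k + 1) ∧ b * a ∈ augPow ε (k + 1) ∧ z = a * b - b * a},
        x - s ∈ augPow ε (k + 2)) {z : K1 Q} (hz : z ∈ K1.augCongr hm N (k + 1))
    (h : K1.logTrace ε hm τ hτ z = 1) : z ∈ K1.augCongr hm N (k + 2) := by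
  obtain ⟨X, hX, rfl⟩ := hz
  rw [K1.logTrace_ofMat ε hm τ hτ hk hX] at h
  obtain ⟨s, hs, ht⟩ := hstep X.trace (Ideal.sum_mem _ fun i _ => hX i i) h
  exact mem_congrStep_of_trace (I := augIdeal ε) hm hX hs ht (add_sub_cancel _ _).symm

theorem K1.augCongr_eq_one (hm : augPow ε m = ⊥) {N k : ℕ} (hk : m ≤ k + 1) {z : K1 Q}
    (hz : z ∈ K1.augCongr hm N (k + 1)) : z = 1 :=
  K1.congr_eq_one (I := augIdeal ε) hm hk hz

/-- An element `t` of a power of the augmentation ideal is realized by the class of `1 + t`. -/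
theorem K1.exists_mk_one_add (hm : augPow ε m = ⊥) {k : ℕ} {t : Q} (ht : t ∈ augPow ε (k + 1)) :
    ∃ A : GL (Fin 1) Q, (A : Matrix (Fin 1) (Fin 1) Q) = 1 + Matrix.of (fun _ _ => t) ∧
      ∀ {V : Type*} [AddCommGroup V] [Module ℚ V] (τ : Q →ₗ[ℚ] V)
        (hτ : ∀ a b, τ (a * b) = τ (b * a)), (∀ x ∈ augPow ε (k + 2), τ x = 0) →
          K1.logTrace ε hm τ hτ (K1.mk A) = Multiplicative.ofAdd (τ t) := by
  have hX : Matrix.of (fun _ _ => t) ∈ (augIdeal ε ^ (k + 1)).matrix (Fin 1) := fun _ _ => ht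
  obtain ⟨A, hA⟩ := isUnit_one_add (I := augIdeal ε) hm (mem_matrix_of_mem_pow_succ hX)
  refine ⟨A, hA, fun τ hτ hk => ?_⟩
  rw [← K1.ofMat_coe, hA, K1.logTrace_ofMat ε hm τ hτ hk hX]
  simp [Matrix.trace]

variable (ε)

/-- The functional `x ↦ [x - ε(x)]` with values in `H₁^Lie(J)`, for the augmentation ideal `J`. -/
def toH1Lie (J : Submodule ℚ Q) (hJ : ∀ x, ε x = 0 ↔ x ∈ J) : Q →ₗ[ℚ] H1Lie J :=
  (commSpan J).mkQ ∘ₗ LinearMap.codRestrict J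
    (LinearMap.id - (Algebra.linearMap ℚ Q) ∘ₗ ε.toLinearMap) fun x => (hJ _).mp (by simp)

/-- Subtracting the scalars `ε(a)` and `ε(b)` does not change the commutator, so commutators in `Q`
are commutators of elements of `J`. -/
theorem toH1Lie_mul_comm (J : Submodule ℚ Q) (hJ : ∀ x, ε x = 0 ↔ x ∈ J) (a b : Q) :
    toH1Lie ε J hJ (a * b) = toH1Lie ε J hJ (b * a) := by
  rw [← sub_eq_zero, ← map_sub, toH1Lie, LinearMap.comp_apply, Submodule.mkQ_apply,
    Submodule.Quotient.mk_eq_zero]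
  refine Submodule.subset_span ⟨⟨a - algebraMap ℚ Q (ε a), (hJ _).mp (by simp)⟩,
    ⟨b - algebraMap ℚ Q (ε b), (hJ _).mp (by simp)⟩, ?_⟩
  have h1 : ε (a * b - b * a) = 0 := by rw [map_sub, map_mul, map_mul, mul_comm, sub_self]
  change (a * b - b * a) - algebraMap ℚ Q (ε (a * b - b * a)) = _
  rw [h1, map_zero, sub_zero]
  have h2 := Algebra.commutes (ε a) b
  have h3 := Algebra.commutes (ε b) a
  have h4 := Algebra.commutes (ε a) (algebraMap ℚ Q (ε b))
  simp only [sub_mul, mul_sub]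
  rw [h2, h3, h4]
  abel

theorem toH1Lie_of_mem (J : Submodule ℚ Q) (hJ : ∀ x, ε x = 0 ↔ x ∈ J) (x : Q) (hx : x ∈ J) :
    toH1Lie ε J hJ x = (commSpan J).mkQ ⟨x, hx⟩ := by
  rw [toH1Lie, LinearMap.comp_apply]
  congr 1
  apply Subtype.ext
  change x - algebraMap ℚ Q (ε x) = x
  rw [(hJ x).mpr hx, map_zero, sub_zero]

end KernelFiltration

/-! ### Classes killed by a reduction homomorphism. -/

section KernelOfReduction

variable {Q : Type*} [Ring Q] [Algebra ℚ Q] {Q' : Type*} [Ring Q'] [Algebra ℚ Q']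
  {ε : Q →ₐ[ℚ] ℚ} {ε' : Q' →ₐ[ℚ] ℚ} {f : Q →ₐ[ℚ] Q'} {m : ℕ}

theorem K1.map_augmentation_eq_one (hf : ∀ x, ε' (f x) = ε x) {z : K1 Q}
    (hz : K1.map (f : Q →+* Q') z = 1) : K1.map (ε : Q →+* ℚ) z = 1 := by
  have h : (ε : Q →+* ℚ) = (ε' : Q' →+* ℚ).comp (f : Q →+* Q') :=
    RingHom.ext fun x => (hf x).symm
  rw [h, ← K1.map_map, hz, map_one]

/-- Let `τ k` be trace functionals of degree `k` that factor through `f` for `k ≤ n`, and that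
detect elements modulo commutators. Then a matrix whose class is killed by `f` has the class of a
matrix congruent to `1` modulo the power `n + 1` of the augmentation ideal. -/
theorem K1.mem_augCongr_of_map_eq_one (hf : ∀ x, ε' (f x) = ε x) (hm : augPow ε m = ⊥)
    (hm' : augPow ε' m = ⊥) {V : ℕ → Type*} [∀ k, AddCommGroup (V k)] [∀ k, Module ℚ (V k)] {n : ℕ}
    (τ : ∀ k ≤ n, Q' →ₗ[ℚ] V k) (hτ : ∀ k (h : k ≤ n) a b, τ k h (a * b) = τ k h (b * a))
    (hk : ∀ k (h : k ≤ n), ∀ x ∈ augPow ε (k + 1), τ k h (f x) = 0)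
    (hstep : ∀ k (h : k + 1 ≤ n), ∀ x ∈ augPow ε (k + 1), τ (k + 1) h (f x) = 0 →
      ∃ s ∈ Submodule.span ℚ {z : Q | ∃ a b : Q,
        a * b ∈ augPow ε (k + 1) ∧ b * a ∈ augPow ε (k + 1) ∧ z = a * b - b * a},
          x - s ∈ augPow ε (k + 2)) {N : ℕ} (A : GL (Fin N) Q)
    (hA : K1.map (f : Q →+* Q') (K1.mk A) = 1) : K1.mk A ∈ K1.augCongr hm N (n + 1) := by
  suffices h : ∀ k ≤ n, K1.mk A ∈ K1.augCongr hm N (k + 1) from h n le_rfl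
  intro k
  induction k with
  | zero => exact fun _ => K1.mem_augCongr_one hm A (K1.map_augmentation_eq_one hf hA)
  | succ k ih =>
    intro hkn
    refine K1.mem_augCongr_succ hm (τ (k + 1) hkn ∘ₗ f.toLinearMap) (fun a b => ?_)
      (hk (k + 1) hkn) (hstep k hkn) (ih (k.le_succ.trans hkn)) ?_
    · simp [hτ]
    -- By naturality the invariant in degree `k + 1` is computed from the image under `f`, which is
    -- trivial.
    · exact (K1.logTrace_map ε ε' f hf hm hm' (τ (k + 1) hkn) (hτ _ hkn) (K1.mk A)).trans
        (by rw [hA, map_one])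

theorem K1.map_mk_one_add_eq_one {t : Q} (ht : f t = 0) {A : GL (Fin 1) Q}
    (hA : (A : Matrix (Fin 1) (Fin 1) Q) = 1 + Matrix.of (fun _ _ => t)) :
    K1.map (f : Q →+* Q') (K1.mk A) = 1 := by
  have h1 : glMap (f : Q →+* Q') 1 A = 1 := by
    apply Units.ext
    ext i j
    change f ((A : Matrix (Fin 1) (Fin 1) Q) i j) = _
    rw [hA, Matrix.add_apply, Matrix.of_apply, map_add, ht, add_zero, Subsingleton.elim i j,
      Matrix.one_apply_eq, map_one]
    simp
  rw [K1.map_mk, h1, K1.mk_one]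

theorem toH1Lie_trace_log (hm : augPow ε m = ⊥) (J : Submodule ℚ Q) (hJ : ∀ x, ε x = 0 ↔ x ∈ J)
    {N : ℕ} (A : GL (Fin N) Q) :
    K1.logTrace ε hm (toH1Lie ε J hJ) (toH1Lie_mul_comm ε J hJ) (K1.mk A) =
      Multiplicative.ofAdd (trClass J (logMatrix (normalized ε A : Matrix (Fin N) (Fin N) Q))
        fun i j => (hJ _).mp (logMatrix_normalized_mem ε A i j)) :=
  congrArg Multiplicative.ofAdd (toH1Lie_of_mem ε J hJ _ _)

theorem H1Lie_map_toH1Lie (J : Submodule ℚ Q) (hJ : ∀ x, ε x = 0 ↔ x ∈ J) (J' : Submodule ℚ Q')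
    (h : ∀ x ∈ J, f.toLinearMap x ∈ J') {t : Q} (ht : ε t = 0) (hft : f t = 0) :
    H1Lie.map f J J' h (toH1Lie ε J hJ t) = 0 := by
  rw [toH1Lie_of_mem _ _ _ _ ((hJ t).mp ht)]
  change (commSpan J').mkQ (f.toLinearMap.restrict h ⟨t, (hJ t).mp ht⟩) = 0
  have h0 : f.toLinearMap.restrict h ⟨t, (hJ t).mp ht⟩ = 0 := Subtype.ext hft
  rw [h0, map_zero]

/-- The trace of the logarithm of a matrix whose class belongs to the last step of the filtration is
killed by `f`. -/
theorem H1Lie_map_trClass_eq_zero {n : ℕ} (hm : augPow ε (n + 2) = ⊥)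
    (hf : ∀ t ∈ augPow ε (n + 1), f t = 0) (J : Submodule ℚ Q) (hJ : ∀ x, ε x = 0 ↔ x ∈ J)
    (J' : Submodule ℚ Q') (h : ∀ x ∈ J, f.toLinearMap x ∈ J') {N N' : ℕ} (A : GL (Fin N) Q)
    (hA : K1.mk A ∈ K1.augCongr hm N' (n + 1)) :
    H1Lie.map f J J' h (trClass J (logMatrix (normalized ε A : Matrix (Fin N) (Fin N) Q))
      fun i j => (hJ _).mp (logMatrix_normalized_mem ε A i j)) = 0 := by
  obtain ⟨t, ht, htr⟩ := K1.exists_of_mem_augCongr _ hA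
  -- The universal functional into `H1Lie` is allowed here because the next power of the
  -- augmentation ideal is zero.
  have h1 := htr _ (toH1Lie_mul_comm ε J hJ) fun x hx => by
    rw [hm] at hx
    rw [(Submodule.mem_bot _).mp hx, map_zero]
  have h2 := Multiplicative.ofAdd.injective ((toH1Lie_trace_log hm J hJ A).symm.trans h1)
  rw [h2]
  exact H1Lie_map_toH1Lie J hJ J' h (Ideal.pow_le_self (Nat.succ_ne_zero n) ht) (hf t ht)

theorem logMatrix_normalized_of_sq_eq_bot (h2 : augPow ε 2 = ⊥) {N : ℕ} (A : GL (Fin N) Q) :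
    logMatrix (normalized ε A : Matrix (Fin N) (Fin N) Q) =
      (normalized ε A : Matrix (Fin N) (Fin N) Q) - 1 := by
  have h := pow_eq_zero_of_mem_matrix (I := augIdeal ε) h2 (normalized_sub_one_mem_matrix ε A)
  rw [logMatrix_normalized ε (m := 2) h2, logTrunc, Finset.sum_range_succ, Finset.sum_range_one, h,
    smul_zero, add_zero]
  simp

theorem trClass_congr (J : Submodule ℚ Q) {N : ℕ} {X Y : Matrix (Fin N) (Fin N) Q} (h : X = Y)
    (hX : ∀ i j, X i j ∈ J) (hY : ∀ i j, Y i j ∈ J) : trClass J X hX = trClass J Y hY := by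
  subst h
  rfl

end KernelOfReduction

section Shortcuts

/-! These instances are found by unification in any case; stating them shortens the search. -/

variable {R : Type*} [Ring R] [Algebra ℚ R] (ε : R →ₐ[ℚ] ℚ)

local instance : Ring (completion ε) := (completion ε).toRing
local instance : Semiring (completion ε) := (completion ε).toSemiring
local instance (m : ℕ) : Ring (HatQuot ε m) := Ideal.Quotient.ring _
local instance (m : ℕ) : Semiring (HatQuot ε m) := (Ideal.Quotient.ring _).toSemiring
local instance (m : ℕ) : AddCommGroup (HatQuot ε m) := Submodule.Quotient.addCommGroup _
local instance (m : ℕ) : AddCommMonoid (HatQuot ε m) := Submodule.Quotient.addCommMonoid _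
local instance (m : ℕ) : Algebra ℚ (HatQuot ε m) := Ideal.Quotient.algebra ℚ
local instance (m : ℕ) : Module ℚ (HatQuot ε m) := Submodule.Quotient.module' _
local instance (m : ℕ) : AddCommGroup (hatQuotIdeal ε m) := Submodule.addCommGroup _
local instance (m : ℕ) : AddCommMonoid (hatQuotIdeal ε m) := Submodule.addCommMonoid _
local instance (m : ℕ) : Module ℚ (hatQuotIdeal ε m) := Submodule.module _

/-! ### The kernel of the reduction for the truncated completion. -/

section CompletedAlgebra

theorem augPow_augQuot_eq_bot (n : ℕ) : augPow (augQuot ε n) (n + 1) = ⊥ :=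
  augPow_eq_bot ε n le_rfl

theorem augQuot_mk (n : ℕ) (x : completion ε) :
    augQuot ε n (Ideal.Quotient.mk _ x) = augHat ε x := rfl

theorem augQuot_red (n : ℕ) (q : HatQuot ε (n + 1 + 1)) :
    augQuot ε n (red ε (n + 1) q) = augQuot ε (n + 1) q := by
  obtain ⟨x, rfl⟩ := Ideal.Quotient.mk_surjective q
  have h : red ε (n + 1) (Ideal.Quotient.mk _ x) = Ideal.Quotient.mk _ x := rfl
  rw [h, augQuot_mk, augQuot_mk]

theorem red_eq_zero_of_mem {n : ℕ} {q : HatQuot ε (n + 1 + 1)}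
    (hq : q ∈ augPow (augQuot ε (n + 1)) (n + 1)) : red ε (n + 1) q = 0 := by
  obtain ⟨x, hx, rfl⟩ := exists_mk_of_mem_augPow ε hq
  exact Ideal.Quotient.eq_zero_iff_mem.mpr hx

theorem redTo_eq_zero_of_mem {n k : ℕ} (h : k ≤ n) {q : HatQuot ε (n + 1 + 1)}
    (hq : q ∈ augPow (augQuot ε (n + 1)) (k + 1)) : redTo ε h (red ε (n + 1) q) = 0 := by
  obtain ⟨x, hx, rfl⟩ := exists_mk_of_mem_augPow ε hq
  exact Ideal.Quotient.eq_zero_iff_mem.mpr hx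

variable {ε} {V : ℕ → Type*} [∀ k, AddCommGroup (V k)] [∀ k, Module ℚ (V k)]
  (φ : ∀ k, HatQuot ε (k + 1) →ₗ[ℚ] V k)

theorem eq_zero_of_mem_augPow_top {W : Type*} [AddCommGroup W] [Module ℚ W] {n : ℕ}
    (τ : HatQuot ε (n + 1) →ₗ[ℚ] W) {q : HatQuot ε (n + 1)}
    (hq : q ∈ augPow (augQuot ε n) (n + 1)) : τ q = 0 := by
  rw [augPow_augQuot_eq_bot] at hq
  rw [(Submodule.mem_bot _).mp hq, map_zero]

variable {φ}

theorem DetectsCommutators.exists_mk (h : DetectsCommutators φ) {n k : ℕ} {x : completion ε}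
    (hx : x ∈ augPow (augHat ε) (k + 1)) (h0 : φ (k + 1) (Ideal.Quotient.mk _ x) = 0) :
    ∃ s ∈ Submodule.span ℚ {z : HatQuot ε (n + 1) | ∃ a c : HatQuot ε (n + 1),
      a * c ∈ augPow (augQuot ε n) (k + 1) ∧ c * a ∈ augPow (augQuot ε n) (k + 1) ∧
        z = a * c - c * a}, Ideal.Quotient.mk _ x - s ∈ augPow (augQuot ε n) (k + 2) := by
  obtain ⟨s, hs, hs'⟩ := h k x hx h0
  refine ⟨Ideal.Quotient.mkₐ ℚ (hatIdeal ε ^ (n + 1)) s, ?_, mk_mem_augPow ε hs'⟩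
  have h2 := Submodule.mem_map_of_mem
    (f := (Ideal.Quotient.mkₐ ℚ (hatIdeal ε ^ (n + 1))).toLinearMap) hs
  rw [Submodule.map_span] at h2
  refine Submodule.span_mono ?_ h2
  rintro _ ⟨_, ⟨y, y', hy, hy', rfl⟩, rfl⟩
  exact ⟨Ideal.Quotient.mk _ y, Ideal.Quotient.mk _ y', mk_mem_augPow ε hy, mk_mem_augPow ε hy',
    rfl⟩

/-- For `k ≤ n` the functional `φ k` lives on `R̂ / Î ^ (k + 1)`, so it factors through the
reduction to `R̂ / Î ^ (n + 1)`, where the class of `A` is trivial. -/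
theorem DetectsCommutators.mem_augCongr (h : DetectsCommutators φ)
    (hφ : ∀ k a b, φ k (a * b) = φ k (b * a)) {n N : ℕ} (A : GL (Fin N) (HatQuot ε (n + 1 + 1)))
    (hA : K1.map (red ε (n + 1) : HatQuot ε (n + 1 + 1) →+* HatQuot ε (n + 1)) (K1.mk A) = 1) :
    K1.mk A ∈ K1.augCongr (augPow_augQuot_eq_bot ε (n + 1)) N (n + 1) := by
  refine K1.mem_augCongr_of_map_eq_one (augQuot_red ε n) (augPow_augQuot_eq_bot ε (n + 1))
    (augPow_eq_bot ε n (Nat.le_succ _)) (fun k hk => φ k ∘ₗ (redTo ε hk).toLinearMap) ?_ ?_ ?_ A hA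
  · intro k hk a b
    have e : redTo ε hk (a * b) = redTo ε hk a * redTo ε hk b := map_mul (redTo ε hk) a b
    have e' : redTo ε hk (b * a) = redTo ε hk b * redTo ε hk a := map_mul (redTo ε hk) b a
    change φ k (redTo ε hk (a * b)) = φ k (redTo ε hk (b * a))
    rw [e, e', hφ]
  · intro k hk x hx
    change φ k (redTo ε hk (red ε (n + 1) x)) = 0
    rw [redTo_eq_zero_of_mem ε hk hx, map_zero]
  · intro k hk q hq h0
    obtain ⟨x, hx, rfl⟩ := exists_mk_of_mem_augPow ε hq
    exact h.exists_mk hx h0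

theorem DetectsCommutators.ldet_mem_ker (h : DetectsCommutators φ)
    (hφ : ∀ k a b, φ k (a * b) = φ k (b * a)) {n N : ℕ} (A : GL (Fin N) (HatQuot ε (n + 1 + 1)))
    (hA : K1.map (red ε (n + 1) : HatQuot ε (n + 1 + 1) →+* HatQuot ε (n + 1)) (K1.mk A) = 1) :
    ldet ε (n + 1) A ∈ LinearMap.ker (H1LieRed ε (n + 1)) :=
  H1Lie_map_trClass_eq_zero (augPow_augQuot_eq_bot ε (n + 1))
    (fun _ ht => red_eq_zero_of_mem ε ht) _ (augQuot_eq_zero_iff ε (n + 1)) _ _ A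
    (h.mem_augCongr hφ A hA)

/-- The vanishing in degree `n + 1` permits one more step of the filtration, and `Î ^ (n + 2)` is
zero in the quotient. -/
theorem DetectsCommutators.eq_one (h : DetectsCommutators φ)
    (hφ : ∀ k a b, φ k (a * b) = φ k (b * a)) {n : ℕ} {z : K1 (HatQuot ε (n + 1 + 1))}
    (hz : K1.map (red ε (n + 1) : HatQuot ε (n + 1 + 1) →+* HatQuot ε (n + 1)) z = 1)
    (h1 : K1.logTrace (augQuot ε (n + 1)) (augPow_augQuot_eq_bot ε (n + 1)) (φ (n + 1))
      (hφ (n + 1)) z = 1) : z = 1 := by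
  obtain ⟨N, A, rfl⟩ := K1.mk_surjective z
  refine K1.augCongr_eq_one _ le_rfl (K1.mem_augCongr_succ _ (φ (n + 1)) (hφ (n + 1))
    (fun x hx => eq_zero_of_mem_augPow_top _ hx) ?_ (h.mem_augCongr hφ A hz) h1)
  intro q hq h0
  obtain ⟨x, hx, rfl⟩ := exists_mk_of_mem_augPow ε hq
  exact h.exists_mk hx h0

/-- Functionals that agree on `Î ^ (n + 1)` define the same homomorphism on the kernel. -/
theorem DetectsCommutators.logTrace_eq (h : DetectsCommutators φ)
    (hφ : ∀ k a b, φ k (a * b) = φ k (b * a)) {n : ℕ}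
    {τ : HatQuot ε (n + 1 + 1) →ₗ[ℚ] V (n + 1)} (hτ : ∀ a b, τ (a * b) = τ (b * a))
    (heq : ∀ x ∈ augPow (augHat ε) (n + 1),
      φ (n + 1) (Ideal.Quotient.mk _ x) = τ (Ideal.Quotient.mk _ x))
    {z : K1 (HatQuot ε (n + 1 + 1))}
    (hz : K1.map (red ε (n + 1) : HatQuot ε (n + 1 + 1) →+* HatQuot ε (n + 1)) z = 1) :
    K1.logTrace (augQuot ε (n + 1)) (augPow_augQuot_eq_bot ε (n + 1)) (φ (n + 1)) (hφ (n + 1)) z =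
      K1.logTrace (augQuot ε (n + 1)) (augPow_augQuot_eq_bot ε (n + 1)) τ hτ z := by
  obtain ⟨N, A, rfl⟩ := K1.mk_surjective z
  obtain ⟨t, ht, htr⟩ := K1.exists_of_mem_augCongr _ (h.mem_augCongr hφ A hz)
  obtain ⟨x, hx, rfl⟩ := exists_mk_of_mem_augPow ε ht
  rw [htr _ _ fun x hx => eq_zero_of_mem_augPow_top _ hx,
    htr _ _ fun x hx => eq_zero_of_mem_augPow_top _ hx, heq x hx]

/-- The class of the `1 × 1` matrix `1 + x` is a witness: its logarithm has leading term `x`, and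
the reduction kills `x`. -/
theorem exists_logTrace_eq {W : Type*} [AddCommGroup W] [Module ℚ W] {n : ℕ}
    (τ : HatQuot ε (n + 1 + 1) →ₗ[ℚ] W) (hτ : ∀ a b, τ (a * b) = τ (b * a)) {x : completion ε}
    (hx : x ∈ augPow (augHat ε) (n + 1)) : ∃ z : K1 (HatQuot ε (n + 1 + 1)),
      K1.map (red ε (n + 1) : HatQuot ε (n + 1 + 1) →+* HatQuot ε (n + 1)) z = 1 ∧
        K1.logTrace (augQuot ε (n + 1)) (augPow_augQuot_eq_bot ε (n + 1)) τ hτ z =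
          Multiplicative.ofAdd (τ (Ideal.Quotient.mk _ x)) := by
  obtain ⟨A, hA, htr⟩ := K1.exists_mk_one_add (augPow_augQuot_eq_bot ε (n + 1)) (mk_mem_augPow ε hx)
  exact ⟨K1.mk A, K1.map_mk_one_add_eq_one (red_eq_zero_of_mem ε (mk_mem_augPow ε hx)) hA,
    htr _ _ fun x hx => eq_zero_of_mem_augPow_top _ hx⟩

variable (ε) in
theorem linDet_one_eq_ldet {N : ℕ} (A : GL (Fin N) (HatQuot ε (1 + 1))) :
    linDet ε 1 A = ldet ε 1 A :=
  trClass_congr _ (logMatrix_normalized_of_sq_eq_bot (augPow_augQuot_eq_bot ε 1) A).symm _ _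

end CompletedAlgebra

/-! ### The log-determinant of a free group of finite rank. -/

section Main

variable {π : Type*} [Group π]

theorem tensorLift_ι_mem (h : RatH1 π) :
    tensorLift π (TensorAlgebra.ι ℚ h) ∈ augIdeal (groupAug π) := by
  rw [tensorLift_ι]
  exact linearLift_mem h

theorem exists_sub_tensorLift_mem (r : MonoidAlgebra ℚ π) (hr : r ∈ augIdeal (groupAug π)) :
    ∃ h : RatH1 π, r - tensorLift π (TensorAlgebra.ι ℚ h) ∈ augIdeal (groupAug π) ^ 2 := by
  obtain ⟨h, hh⟩ := exists_sub_linearLift_mem hr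
  exact ⟨h, by rw [tensorLift_ι]; exact hh⟩

theorem MagnusExpansion.extendsCycPart (θ : MagnusExpansion π) :
    ExtendsCycPart (ε := groupAug π) (tensorLift π) θ.cycHat := by
  intro k t ht
  change cycPart (RatH1 π) k (tensorCoeff (RatH1 π) k (θ.algHom (tensorLift π t))) = _
  rw [θ.tensorCoeff_tensorLift ht]

theorem MagnusExpansion.detectsCommutators {κ : Type*} [Fintype κ] (b : FreeGroupBasis κ π)
    (θ : MagnusExpansion π) : DetectsCommutators (ε := groupAug π) θ.cycHat :=
  θ.extendsCycPart.detectsCommutators tensorLift_ι_mem exists_sub_tensorLift_mem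
    (fun i => subOne_mem (b i)) fun _ hr => exists_coeff_of_mem_augIdeal b hr

theorem MagnusExpansion.cycHat_eq {κ : Type*} [Fintype κ] (b : FreeGroupBasis κ π)
    (θ θ' : MagnusExpansion π) {k : ℕ} {x : completion (groupAug π)}
    (hx : x ∈ augPow (augHat (groupAug π)) k) :
    θ.cycHat k (Ideal.Quotient.mk _ x) = θ'.cycHat k (Ideal.Quotient.mk _ x) :=
  θ.extendsCycPart.eq_on θ'.extendsCycPart tensorLift_ι_mem exists_sub_tensorLift_mem
    (fun i => subOne_mem (b i)) (fun _ hr => exists_coeff_of_mem_augIdeal b hr) hx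

/-- The homomorphism `A ↦ θ_*(tr (log (A ε(A)⁻¹)))` on `K₁`. -/
def MagnusExpansion.logDet (θ : MagnusExpansion π) (n : ℕ) :
    K1 (HatQuot (groupAug π) (n + 1)) →* Multiplicative (CycTensor (RatH1 π) n) :=
  K1.logTrace (augQuot (groupAug π) n) (augPow_augQuot_eq_bot (groupAug π) n) (θ.cycHat n)
    (θ.cycHat_mul_comm n)

/-- The map is built from one expansion `θ` but has to satisfy the formula for every `θ'`. On the
kernel only `Î ^ (n + 1)` matters, and there `cycHat_eq` identifies the two functionals. -/
theorem MagnusExpansion.isLogDet {κ : Type*} [Fintype κ] (b : FreeGroupBasis κ π)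
    (θ : MagnusExpansion π) (n : ℕ) :
    IsLogDet (n + 1) ((θ.logDet (n + 1)).comp (K1Ker π (n + 1)).subtype) :=
  fun θ' _ A hA =>
    Exists.intro
      (DetectsCommutators.ldet_mem_ker (ε := groupAug π) (θ.detectsCommutators b)
        θ.cycHat_mul_comm A (MonoidHom.mem_ker.mp hA))
      (DetectsCommutators.logTrace_eq (ε := groupAug π) (θ.detectsCommutators b)
        θ.cycHat_mul_comm (θ'.cycHat_mul_comm (n + 1)) (fun _ hx => θ.cycHat_eq b θ' hx)
        (MonoidHom.mem_ker.mp hA))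

/-- An expansion has to exist, since otherwise the condition `IsLogDet` would be empty; given one,
the formula fixes the value on every class. -/
theorem IsLogDet.eq {n : ℕ} {Φ Ψ : K1Ker π n →* Multiplicative (CycTensor (RatH1 π) n)}
    (θ : MagnusExpansion π) (hΦ : IsLogDet n Φ) (hΨ : IsLogDet n Ψ) : Ψ = Φ :=
  MonoidHom.ext fun z =>
    (K1.mk_surjective z.1).elim fun N h => h.elim fun A e =>
      have hA : K1.mk A ∈ K1Ker π n := Eq.mpr (congrArg (· ∈ K1Ker π n) e) z.2
      have hz : z = ⟨K1.mk A, hA⟩ := Subtype.ext e.symm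
      (hΦ θ N A hA).elim fun _ h => (hΨ θ N A hA).elim fun _ h' =>
        (congrArg Ψ hz).trans ((h'.trans h.symm).trans (congrArg Φ hz.symm))

theorem MagnusExpansion.logDet_injective {κ : Type*} [Fintype κ] (b : FreeGroupBasis κ π)
    (θ : MagnusExpansion π) (n : ℕ) :
    Function.Injective ((θ.logDet (n + 1)).comp (K1Ker π (n + 1)).subtype) :=
  (injective_iff_map_eq_one _).mpr fun z h =>
    Subtype.ext (DetectsCommutators.eq_one (ε := groupAug π) (θ.detectsCommutators b)
      θ.cycHat_mul_comm (MonoidHom.mem_ker.mp z.2) h)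

theorem MagnusExpansion.logDet_surjective (θ : MagnusExpansion π) (n : ℕ) :
    Function.Surjective ((θ.logDet (n + 1)).comp (K1Ker π (n + 1)).subtype) :=
  fun c =>
    (θ.extendsCycPart.exists_eq tensorLift_ι_mem (k := n + 1) c.toAdd).elim fun _ hx =>
      (exists_logTrace_eq (ε := groupAug π) (θ.cycHat (n + 1))
        (θ.cycHat_mul_comm (n + 1)) hx.1).elim fun z hz =>
          Exists.intro ⟨z, MonoidHom.mem_ker.mpr hz.1⟩
            (hz.2.trans (congrArg Multiplicative.ofAdd hx.2))

/-- There is exactly one log-determinant in degree `n`, and it is bijective. -/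
def HasUniqueLogDet (π : Type*) [Group π] (n : ℕ) : Prop :=
  ∃ Φ : K1Ker π n →* Multiplicative (CycTensor (RatH1 π) n),
    IsLogDet n Φ ∧
    (∀ Ψ : K1Ker π n →* Multiplicative (CycTensor (RatH1 π) n), IsLogDet n Ψ → Ψ = Φ) ∧
    Function.Bijective Φ

theorem hasUniqueLogDet_succ {κ : Type*} [Fintype κ] (b : FreeGroupBasis κ π)
    (θ : MagnusExpansion π) (n : ℕ) : HasUniqueLogDet π (n + 1) :=
  Exists.intro _ (And.intro (θ.isLogDet b n)
    (And.intro (fun _ hΨ => (θ.isLogDet b n).eq θ hΨ)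
      (And.intro (θ.logDet_injective b n) (θ.logDet_surjective n))))

theorem hasUniqueLogDet {κ : Type*} [Fintype κ] (b : FreeGroupBasis κ π) {n : ℕ} (hn : 1 ≤ n) :
    HasUniqueLogDet π n := by
  obtain ⟨θ⟩ := exists_magnusExpansion b
  obtain ⟨m, rfl⟩ := Nat.exists_eq_add_of_le' hn
  exact hasUniqueLogDet_succ b θ m

theorem IsLogDet.eq_linDet {Φ : K1Ker π 1 →* Multiplicative (CycTensor (RatH1 π) 1)}
    (hΦ : IsLogDet 1 Φ) (θ : MagnusExpansion π) (N : ℕ)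
    (A : GL (Fin N) (HatQuot (groupAug π) (1 + 1))) (hA : K1.mk A ∈ K1Ker π 1) :
    ∃ h : linDet (groupAug π) 1 A ∈ LinearMap.ker (H1LieRed (groupAug π) 1),
      Φ ⟨K1.mk A, hA⟩ =
        Multiplicative.ofAdd (θ.star 1 ⟨linDet (groupAug π) 1 A, h⟩) :=
  (hΦ θ N A hA).elim fun h h' =>
    have e := linDet_one_eq_ldet (groupAug π) A
    Exists.intro (Eq.mpr (congrArg (· ∈ LinearMap.ker (H1LieRed (groupAug π) 1)) e) h)
      (h'.trans (congrArg Multiplicative.ofAdd (congrArg (θ.starAux 1) e.symm)))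

end Main

end Shortcuts

end LogDet

end

open LogDet in
theorem corollary4p7 {π : Type*} [Group π] (g : ℕ) (_b : FreeGroupBasis (Fin (2 * g)) π) :
    (∀ n : ℕ, 1 ≤ n →
      ∃ Φ : K1Ker π n →* Multiplicative (CycTensor (RatH1 π) n),
        IsLogDet n Φ ∧
        (∀ Ψ : K1Ker π n →* Multiplicative (CycTensor (RatH1 π) n), IsLogDet n Ψ → Ψ = Φ) ∧
        Function.Bijective Φ) ∧
    (∀ Φ : K1Ker π 1 →* Multiplicative (CycTensor (RatH1 π) 1), IsLogDet 1 Φ →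
      ∀ (θ : MagnusExpansion π) (N : ℕ) (A : GL (Fin N) (HatQuot (groupAug π) (1 + 1)))
        (hA : K1.mk A ∈ K1Ker π 1),
        ∃ h : linDet (groupAug π) 1 A ∈ LinearMap.ker (H1LieRed (groupAug π) 1),
          Φ ⟨K1.mk A, hA⟩ =
            Multiplicative.ofAdd (θ.star 1 ⟨linDet (groupAug π) 1 A, h⟩)) := by
  exact And.intro (fun _ hn => hasUniqueLogDet _b hn) (fun _ hΦ => hΦ.eq_linDet)
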